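/- For finite groups $G,H$, let $B(G)$ be the Burnside ring of $G$ (the Grothendieck ring of finite $G$-sets), and $B(H,G)=B(H\times G^{op})$ the Burnside group of finite $(H,G)$-bisets. For $a\in B(G)$ and $K\le G$, let $|a^K|\in\mathbb{Z}$ denote the image of $a$ under the ring homomorphism $B(G)\to\mathbb{Z}$ sending a finite $G$-set $X$ to the number of its $K$-fixed points. Let $\mathbb{F}_2\mathcal{C}$ be the category whose objects are the finite groups, with $\mathrm{Hom}(G,H)=\mathbb{F}_2\otimes_{\mathbb Z} B(H,G)$, and with composition induced by $V\times_HU=(V\times U)/H$. A biset functor over $\mathbb{F}_2$ is an $\mathbb{F}_2$-linear functor from $\mathbb{F}_2\mathcal{C}$ to $\mathbb{F}_2$-vector spaces. An element of a biset functor $F$ is a pair $(R,v)$ with $R$ a finite group and $v\in F(R)$; for a set $\mathcal{G}$ of elements, $\langle\mathcal{G}\rangle$ is the intersection of all subfunctors of $F$ containing $\mathcal{G}$. The functor $F$ is finitely generated if $F=\langle\mathcal{G}\rangle$ for some finite set $\mathcal{G}$, and finitely presented if there is an exact sequence $Q\to P\to F\to 0$ of biset functors with $P$ and $Q$ finitely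 generated and projective. Let $\mathbb{F}_2B$ be the linearized Burnside functor $G\mapsto\mathbb{F}_2\otimes B(G)$ (with $[U][X]=[U\times_GX]$). Let $B^\times$ be the biset functor over $\mathbb{F}_2$ whose value at $G$ is the group of units of $B(G)$ (an elementary abelian $2$-group), where an $(H,G)$-biset $U$ acts by tensor induction, i.e. by the multiplicative map $T_U:B(G)\to B(H)$ which extends $X\mapsto\mathrm{Hom}_G(U^{op},X)$ and satisfies $|T_U(a)^K|=\prod_{u\in K\backslash U/G}|a^{K^u}|$ for all $K\le H$, with $K^u=\{g\in G\mid ug\in Ku\}$. Let $\widehat{B^\times}=\mathrm{Hom}_{\mathbb{F}_2}(B^\times,\mathbb{F}_2)$ be its dual functor, on which $\alpha\in\mathbb{F}_2B(H,G)$ acts by the transpose of $B^\times(\alpha^{op})$. Let $\jmath:\mathbb{F}_2B\to\widehat{B^\times}$ be the morphism of biset functors sending $G/K$ to the linear form $u\mapsto|u^K|_+$, where $(+1)_+=0$ and $(-1)_+=1$, and let $L=\mathrm{Ker}\,\jmath$. Then: 1. $\widehat{B^\times}(\mathbf{1})\cong\mathbb{F}_2$, and if $u$ is its non-zero element, then $\langle\{(\mathbf{1},u)\}\rangle=\widehat{B^\times}$.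 2. The functor $L$ is not finitely generated. 3. The functor $\widehat{B^\times}$ is not finitely presented. -/

import Mathlib

open CategoryTheory MulOpposite
open scoped TensorProduct

noncomputable section

namespace BurnsideUnits


/-! ### The Grothendieck group and ring -/

section Grothendieck

/-- The Grothendieck group of a commutative additive monoid. -/
def Gro (M : Type) [AddCommMonoid M] : Type := Algebra.GrothendieckAddGroup M

variable {M N : Type} [AddCommMonoid M] [AddCommMonoid N] {C : Type} [AddCommGroup C]

instance : AddCommGroup (Gro M) :=
  inferInstanceAs (AddCommGroup (Algebra.GrothendieckAddGroup M))

namespace Gro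

def of : M →+ Gro M := Algebra.GrothendieckAddGroup.of (M := M)

theorem ind {P : Gro M → Prop} (h : ∀ x y : M, P (of x - of y)) (a : Gro M) : P a := by
  obtain ⟨⟨x, y⟩, hxy⟩ := (AddLocalization.addMonoidOf (⊤ : AddSubmonoid M)).surj a
  have : a = of x - of (y : M) := eq_sub_of_add_eq hxy
  rw [this]
  exact h _ _

@[ext]
theorem hom_ext {f g : Gro M →+ C} (h : ∀ x, f (of x) = g (of x)) : f = g := by
  ext a
  induction a using ind with
  | h x y => rw [map_sub, map_sub, h, h]

/-- The universal property of the Grothendieck group. -/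
def lift (f : M →+ C) : Gro M →+ C := Algebra.GrothendieckAddGroup.lift f

@[simp]
theorem lift_of (f : M →+ C) (x : M) : lift f (of x) = f x :=
  DFunLike.congr_fun (Algebra.GrothendieckAddGroup.lift.symm_apply_apply f) x

/-- The biadditive version of the universal property. -/
def lift₂ (f : M →+ N →+ C) : Gro M →+ Gro N →+ C :=
  lift { toFun := fun x => lift (f x)
         map_zero' := by ext; simp
         map_add' := fun x y => by ext; simp }

@[simp]
theorem lift₂_of (f : M →+ N →+ C) (x : M) (y : N) : lift₂ f (of x) (of y) = f x y := by
  simp [lift₂]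

section Ring

variable {S : Type} [CommSemiring S]

def mulHom : Gro S →+ Gro S →+ Gro S :=
  lift₂ (((AddMonoidHom.compHom (of : S →+ Gro S))).comp AddMonoidHom.mul)

theorem mulHom_of (x y : S) : mulHom (of x) (of y) = of (x * y) := by
  simp [mulHom]

/-- The Grothendieck group of a commutative semiring is a commutative ring. -/
instance : CommRing (Gro S) :=
  { (inferInstance : AddCommGroup (Gro S)) with
    mul := fun a b => mulHom a b
    one := of 1
    left_distrib := fun a b c => map_add (mulHom a) b c
    right_distrib := fun a b c => by
      change mulHom (a + b) c = mulHom a c + mulHom b c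
      rw [map_add]; rfl
    zero_mul := fun a => by
      change mulHom 0 a = 0
      rw [map_zero]; rfl
    mul_zero := fun a => map_zero (mulHom a)
    mul_assoc := fun a b c => by
      change mulHom (mulHom a b) c = mulHom a (mulHom b c)
      induction a using ind with
      | h a a' =>
      induction b using ind with
      | h b b' =>
      induction c using ind with
      | h c c' =>
      simp only [map_sub, AddMonoidHom.sub_apply, mulHom_of, mul_assoc]
    one_mul := fun a => by
      change mulHom (of 1) a = a
      induction a using ind with
      | h a a' => simp only [map_sub, mulHom_of, one_mul]
    mul_one := fun a => by
      change mulHom a (of 1) = a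
      induction a using ind with
      | h a a' => simp only [map_sub, AddMonoidHom.sub_apply, mulHom_of, mul_one]
    mul_comm := fun a b => by
      change mulHom a b = mulHom b a
      induction a using ind with
      | h a a' =>
      induction b using ind with
      | h b b' =>
      simp only [map_sub, AddMonoidHom.sub_apply, mulHom_of, mul_comm]
      abel }

theorem of_mul (x y : S) : (of (x * y) : Gro S) = of x * of y := (mulHom_of x y).symm

theorem of_one : (of 1 : Gro S) = 1 := rfl

/-- The universal property of the Grothendieck ring. -/
def liftRing {R : Type} [CommRing R] (f : S →+* R) : Gro S →+* R :=
  { lift (f : S →+ R) with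
    map_one' := by
      change lift (f : S →+ R) (of 1) = 1
      simp
    map_mul' := fun a b => by
      change lift (f : S →+ R) (a * b) = lift (f : S →+ R) a * lift (f : S →+ R) b
      induction a using ind with
      | h a a' =>
      induction b using ind with
      | h b b' =>
      simp only [sub_mul, mul_sub, map_sub, ← of_mul, lift_of]
      simp }

@[simp]
theorem liftRing_of {R : Type} [CommRing R] (f : S →+* R) (x : S) : liftRing f (of x) = f x :=
  lift_of (f : S →+ R) x

end Ring

end Gro

end Grothendieck

/-! ### Isomorphism classes of finite `G`-sets -/

section GSets

/-- Two `G`-sets are isomorphic. -/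
def GIso (G : Type) [Group G] (X Y : Type) [MulAction G X] [MulAction G Y] : Prop :=
  ∃ e : X ≃ Y, ∀ (g : G) (x : X), e (g • x) = g • e x

variable {G : Type} [Group G]

theorem GIso.refl (X : Type) [MulAction G X] : GIso G X X := ⟨Equiv.refl X, fun _ _ => rfl⟩

theorem GIso.symm {X Y : Type} [MulAction G X] [MulAction G Y] (h : GIso G X Y) :
    GIso G Y X := by
  obtain ⟨e, he⟩ := h
  exact ⟨e.symm, fun g y => by rw [Equiv.symm_apply_eq, he, Equiv.apply_symm_apply]⟩

theorem GIso.trans {X Y Z : Type} [MulAction G X] [MulAction G Y] [MulAction G Z]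
    (h : GIso G X Y) (h' : GIso G Y Z) : GIso G X Z := by
  obtain ⟨e, he⟩ := h
  obtain ⟨f, hf⟩ := h'
  exact ⟨e.trans f, fun g y => by simp [he, hf]⟩

/-- A `G`-set with underlying set `{0, …, n - 1}`; every finite `G`-set is isomorphic to one. -/
structure FinGSet (G : Type) [Group G] where
  n : ℕ
  act : MulAction G (Fin n)

variable (G) in
/-- Isomorphism of `G`-sets as an equivalence relation. -/
def gsetSetoid : Setoid (FinGSet G) where
  r a b := @GIso G _ (Fin a.n) (Fin b.n) a.act b.act
  iseqv :=
    { refl := fun a => letI := a.act; GIso.refl _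
      symm := fun {a b} h => letI := a.act; letI := b.act; GIso.symm h
      trans := fun {a b c} h h' =>
        letI := a.act; letI := b.act; letI := c.act; GIso.trans h h' }

variable (G) in
/-- The set of isomorphism classes of finite `G`-sets. -/
def GSetClass : Type := Quotient (gsetSetoid G)

namespace GSetClass

/-- The action of `G` on `{0, …, n - 1}` transported from a `G`-set of cardinality `n`. -/
def model (G : Type) [Group G] (X : Type) [Finite X] [MulAction G X] : FinGSet G where
  n := Nat.card X
  act :=
    { smul := fun g i => Finite.equivFin X (g • (Finite.equivFin X).symm i)
      one_smul := fun i => by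
        change Finite.equivFin X ((1 : G) • (Finite.equivFin X).symm i) = i
        simp
      mul_smul := fun g h i => by
        change Finite.equivFin X ((g * h) • (Finite.equivFin X).symm i) =
          Finite.equivFin X (g • (Finite.equivFin X).symm
            (Finite.equivFin X (h • (Finite.equivFin X).symm i)))
        simp [mul_smul] }

theorem model_iso (X : Type) [Finite X] [MulAction G X] :
    letI := (model G X).act
    GIso G X (Fin (model G X).n) := by
  let _ := (model G X).act
  refine ⟨Finite.equivFin X, fun g x => ?_⟩
  change _ = Finite.equivFin X (g • (Finite.equivFin X).symm (Finite.equivFin X x))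
  rw [Equiv.symm_apply_apply]
  rfl

/-- The isomorphism class of a finite `G`-set. -/
def mk (G : Type) [Group G] (X : Type) [Finite X] [MulAction G X] : GSetClass G :=
  Quotient.mk (gsetSetoid G) (model G X)

theorem mk_eq_mk_iff {X Y : Type} [Finite X] [Finite Y] [MulAction G X] [MulAction G Y] :
    mk G X = mk G Y ↔ GIso G X Y := by
  let _ := (model G X).act
  let _ := (model G Y).act
  constructor
  · intro h
    have h' : GIso G (Fin (model G X).n) (Fin (model G Y).n) := Quotient.exact h
    exact (model_iso X).trans (h'.trans (model_iso Y).symm)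
  · intro h
    exact Quotient.sound (s := gsetSetoid G)
      ((model_iso X).symm.trans (h.trans (model_iso Y)))

theorem mk_eq_mk {X Y : Type} [Finite X] [Finite Y] [MulAction G X] [MulAction G Y]
    (e : X ≃ Y) (he : ∀ (g : G) (x : X), e (g • x) = g • e x) : mk G X = mk G Y :=
  mk_eq_mk_iff.2 ⟨e, he⟩

theorem ind {P : GSetClass G → Prop}
    (h : ∀ (X : Type) [Finite X] [MulAction G X], P (mk G X)) (a : GSetClass G) : P a := by
  refine Quotient.inductionOn (s := gsetSetoid G) a fun s => ?_
  let _ := s.act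
  have : Quotient.mk (gsetSetoid G) s = mk G (Fin s.n) :=
    Quotient.sound (s := gsetSetoid G) (model_iso (Fin s.n))
  rw [this]
  exact h _

/-- Functions on isomorphism classes from isomorphism invariants of finite `G`-sets. -/
def lift {α : Type} (f : ∀ (X : Type) [Finite X] [MulAction G X], α)
    (hf : ∀ (X Y : Type) [Finite X] [Finite Y] [MulAction G X] [MulAction G Y],
      GIso G X Y → f X = f Y) (a : GSetClass G) : α :=
  Quotient.lift (s := gsetSetoid G) (fun s => letI := s.act; f (Fin s.n))
    (fun a b h => letI := a.act; letI := b.act; hf (Fin a.n) (Fin b.n) h) a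

theorem lift_mk {α : Type} (f : ∀ (X : Type) [Finite X] [MulAction G X], α)
    (hf : ∀ (X Y : Type) [Finite X] [Finite Y] [MulAction G X] [MulAction G Y],
      GIso G X Y → f X = f Y) (X : Type) [Finite X] [MulAction G X] :
    lift f hf (mk G X) = f X := by
  let _ := (model G X).act
  exact hf _ _ (model_iso X).symm

end GSetClass

/-- The empty `G`-set. -/
instance emptyAction : MulAction G Empty where
  smul _ x := x
  one_smul x := x.elim
  mul_smul _ _ x := x.elim

namespace GSetClass

instance : Zero (GSetClass G) := ⟨mk G Empty⟩

instance : One (GSetClass G) := ⟨mk G Unit⟩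

/-- Disjoint union. -/
instance : Add (GSetClass G) :=
  ⟨fun a b => lift (fun X _ _ => lift (fun Y _ _ => mk G (X ⊕ Y))
    (fun Y Y' _ _ _ _ ⟨e, he⟩ => mk_eq_mk (Equiv.sumCongr (Equiv.refl X) e) (by
      rintro g (x | y) <;> simp [he]) ) b)
    (fun X X' _ _ _ _ ⟨e, he⟩ => by
      induction b using ind with
      | h Y =>
      rw [lift_mk, lift_mk]
      exact mk_eq_mk (Equiv.sumCongr e (Equiv.refl Y)) (by rintro g (x | y) <;> simp [he])) a⟩

/-- Cartesian product. -/
instance : Mul (GSetClass G) :=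
  ⟨fun a b => lift (fun X _ _ => lift (fun Y _ _ => mk G (X × Y))
    (fun Y Y' _ _ _ _ ⟨e, he⟩ => mk_eq_mk (Equiv.prodCongr (Equiv.refl X) e) (by
      rintro g ⟨x, y⟩; simp [he]) ) b)
    (fun X X' _ _ _ _ ⟨e, he⟩ => by
      induction b using ind with
      | h Y =>
      rw [lift_mk, lift_mk]
      exact mk_eq_mk (Equiv.prodCongr e (Equiv.refl Y)) (by rintro g ⟨x, y⟩; simp [he])) a⟩

section

variable (X Y : Type) [Finite X] [Finite Y] [MulAction G X] [MulAction G Y]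

theorem mk_add : mk G X + mk G Y = mk G (X ⊕ Y) := by
  change lift _ _ _ = _
  rw [lift_mk, lift_mk]

theorem mk_mul : mk G X * mk G Y = mk G (X × Y) := by
  change lift _ _ _ = _
  rw [lift_mk, lift_mk]

theorem zero_def : (0 : GSetClass G) = mk G Empty := rfl

theorem one_def : (1 : GSetClass G) = mk G Unit := rfl

end

/-- Isomorphism classes of finite `G`-sets form a commutative semiring. -/
instance : CommSemiring (GSetClass G) where
  add_assoc a b c := by
    induction a using ind with | h X =>
    induction b using ind with | h Y =>
    induction c using ind with | h Z =>
    simp only [mk_add]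
    exact mk_eq_mk (Equiv.sumAssoc X Y Z) (by rintro g ((x | y) | z) <;> rfl)
  zero_add a := by
    induction a using ind with | h X =>
    simp only [mk_add, zero_def]
    exact mk_eq_mk (Equiv.emptySum Empty X) (by rintro g (x | y); exacts [x.elim, rfl])
  add_zero a := by
    induction a using ind with | h X =>
    simp only [mk_add, zero_def]
    exact mk_eq_mk (Equiv.sumEmpty X Empty) (by rintro g (x | y); exacts [rfl, y.elim])
  add_comm a b := by
    induction a using ind with | h X =>
    induction b using ind with | h Y =>
    simp only [mk_add]
    exact mk_eq_mk (Equiv.sumComm X Y) (by rintro g (x | y) <;> rfl)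
  nsmul := nsmulRec
  left_distrib a b c := by
    induction a using ind with | h X =>
    induction b using ind with | h Y =>
    induction c using ind with | h Z =>
    simp only [mk_add, mk_mul]
    exact mk_eq_mk (Equiv.prodSumDistrib X Y Z) (by rintro g ⟨x, (y | z)⟩ <;> rfl)
  right_distrib a b c := by
    induction a using ind with | h X =>
    induction b using ind with | h Y =>
    induction c using ind with | h Z =>
    simp only [mk_add, mk_mul]
    exact mk_eq_mk (Equiv.sumProdDistrib X Y Z) (by rintro g ⟨(x | y), z⟩ <;> rfl)
  zero_mul a := by
    induction a using ind with | h X =>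
    simp only [mk_mul, zero_def]
    exact mk_eq_mk (Equiv.equivOfIsEmpty _ _) (by rintro g ⟨x, y⟩; exact x.elim)
  mul_zero a := by
    induction a using ind with | h X =>
    simp only [mk_mul, zero_def]
    exact mk_eq_mk (Equiv.equivOfIsEmpty _ _) (by rintro g ⟨x, y⟩; exact y.elim)
  mul_assoc a b c := by
    induction a using ind with | h X =>
    induction b using ind with | h Y =>
    induction c using ind with | h Z =>
    simp only [mk_mul]
    exact mk_eq_mk (Equiv.prodAssoc X Y Z) (by rintro g ⟨⟨x, y⟩, z⟩; rfl)
  one_mul a := by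
    induction a using ind with | h X =>
    simp only [mk_mul, one_def]
    exact mk_eq_mk (Equiv.punitProd X) (by rintro g ⟨x, y⟩; rfl)
  mul_one a := by
    induction a using ind with | h X =>
    simp only [mk_mul, one_def]
    exact mk_eq_mk (Equiv.prodPUnit X) (by rintro g ⟨x, y⟩; rfl)
  mul_comm a b := by
    induction a using ind with | h X =>
    induction b using ind with | h Y =>
    simp only [mk_mul]
    exact mk_eq_mk (Equiv.prodComm X Y) (by rintro g ⟨x, y⟩; rfl)

end GSetClass

/-- The Burnside ring `B(G)`: the Grothendieck ring of finite `G`-sets, with respect to disjoint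
union and cartesian product. -/
abbrev Burnside (G : Type) [Group G] : Type := Gro (GSetClass G)

/-- The class of a finite `G`-set in the Burnside ring. -/
def cls (G : Type) [Group G] (X : Type) [Finite X] [MulAction G X] : Burnside G :=
  Gro.of (GSetClass.mk G X)

end GSets


/-! ### Bisets -/

section Bisets

/-- Isomorphism classes of finite `(H, G)`-bisets, i.e. of finite `H × Gᵒᵖ`-sets. The Burnside
group `B(H, G)` is the Grothendieck group of this monoid. -/
abbrev BisetClass (H G : Type) [Group H] [Group G] : Type := GSetClass (H × Gᵐᵒᵖ)

variable (K H G : Type) [Group K] [Group H] [Group G]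

theorem left_right_comm {H N X : Type} [Group H] [Group N] [MulAction (H × N) X] (h : H) (n : N)
    (x : X) : ((h, 1) : H × N) • ((1, n) : H × N) • x = ((1, n) : H × N) • ((h, 1) : H × N) • x := by
  simp [smul_smul]

theorem left_right {H N X : Type} [Group H] [Group N] [MulAction (H × N) X] (h : H) (n : N)
    (x : X) : ((h, n) : H × N) • x = ((h, 1) : H × N) • ((1, n) : H × N) • x := by
  simp [smul_smul]

/-- The set `G` as a `(G, G)`-biset, by left and right multiplication. -/
@[ext]
structure IdBiset : Type where
  val : G

/-- The underlying bijection. -/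
def IdBiset.equiv : IdBiset G ≃ G := ⟨IdBiset.val, IdBiset.mk, fun _ => rfl, fun _ => rfl⟩

instance [Finite G] : Finite (IdBiset G) := Finite.of_equiv G (IdBiset.equiv G).symm

instance : MulAction (G × Gᵐᵒᵖ) (IdBiset G) where
  smul p x := ⟨p.1 * x.val * p.2.unop⟩
  one_smul x := by
    ext
    change 1 * x.val * 1 = x.val
    simp
  mul_smul p q x := by
    ext
    change p.1 * q.1 * x.val * (q.2.unop * p.2.unop) =
      p.1 * (q.1 * x.val * q.2.unop) * p.2.unop
    simp [mul_assoc]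

theorem idBiset_smul (p : G × Gᵐᵒᵖ) (x : IdBiset G) :
    p • x = ⟨p.1 * x.val * p.2.unop⟩ := rfl

section Op

variable (U : Type) [MulAction (H × Gᵐᵒᵖ) U]

/-- The opposite of an `(H, G)`-biset `U`: the `(G, H)`-biset `U` with `g · u · h = h⁻¹ u g⁻¹`. -/
@[ext]
structure OpBiset (_H _G U : Type) : Type where
  val : U

/-- The underlying bijection. -/
def OpBiset.equiv : OpBiset H G U ≃ U := ⟨OpBiset.val, OpBiset.mk, fun _ => rfl, fun _ => rfl⟩

instance [Finite U] : Finite (OpBiset H G U) := Finite.of_equiv U (OpBiset.equiv H G U).symm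

instance : MulAction (G × Hᵐᵒᵖ) (OpBiset H G U) where
  smul p u := ⟨((p.2.unop⁻¹, op p.1⁻¹) : H × Gᵐᵒᵖ) • u.val⟩
  one_smul u := by
    ext
    change (((1 : H)⁻¹, op (1 : G)⁻¹) : H × Gᵐᵒᵖ) • u.val = u.val
    simp [← Prod.one_eq_mk]
  mul_smul p q u := by
    ext
    change (((q.2.unop * p.2.unop)⁻¹, op (p.1 * q.1)⁻¹) : H × Gᵐᵒᵖ) • u.val =
      ((p.2.unop⁻¹, op p.1⁻¹) : H × Gᵐᵒᵖ) • ((q.2.unop⁻¹, op q.1⁻¹) : H × Gᵐᵒᵖ) • u.val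
    simp [smul_smul]

variable {H G U} in
theorem opBiset_smul (p : G × Hᵐᵒᵖ) (u : OpBiset H G U) :
    p • u = ⟨((p.2.unop⁻¹, op p.1⁻¹) : H × Gᵐᵒᵖ) • u.val⟩ := rfl

end Op

section Comp

variable (V U : Type) [MulAction (K × Hᵐᵒᵖ) V] [MulAction (H × Gᵐᵒᵖ) U]

/-- The orbit relation of `H` acting on the right on `V × U` by `(v, u) h = (v h, h⁻¹ u)`. -/
def compSetoid : Setoid (V × U) where
  r p q := ∃ h : H, q = (((1, op h) : K × Hᵐᵒᵖ) • p.1, ((h⁻¹, 1) : H × Gᵐᵒᵖ) • p.2)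
  iseqv :=
    { refl := fun p => ⟨1, by
        have h1 : ((1, op 1) : K × Hᵐᵒᵖ) = 1 := rfl
        have h2 : (((1 : H)⁻¹, 1) : H × Gᵐᵒᵖ) = 1 := by simp
        rw [h1, h2, one_smul, one_smul]⟩
      symm := by
        rintro p q ⟨h, rfl⟩
        refine ⟨h⁻¹, ?_⟩
        simp [smul_smul, ← Prod.one_eq_mk]
      trans := by
        rintro p q r ⟨h, rfl⟩ ⟨h', rfl⟩
        refine ⟨h * h', ?_⟩
        simp [smul_smul] }

/-- The composition `V ×_H U = (V × U) / H` of a `(K, H)`-biset `V` and an `(H, G)`-biset `U`. -/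
def Comp : Type := Quotient (compSetoid K H G V U)

instance [Finite V] [Finite U] : Finite (Comp K H G V U) :=
  inferInstanceAs (Finite (Quotient (compSetoid K H G V U)))

variable {V U}

def Comp.mk (v : V) (u : U) : Comp K H G V U := Quotient.mk (compSetoid K H G V U) (v, u)

variable {K H G}

theorem Comp.ind {P : Comp K H G V U → Prop} (h : ∀ v u, P (Comp.mk K H G v u))
    (x : Comp K H G V U) : P x :=
  Quotient.inductionOn (s := compSetoid K H G V U) x fun p => h p.1 p.2

theorem Comp.mk_right_left (h : H) (v : V) (u : U) :
    Comp.mk K H G (((1, op h) : K × Hᵐᵒᵖ) • v) u = Comp.mk K H G v (((h, 1) : H × Gᵐᵒᵖ) • u) := by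
  refine (Quotient.sound (s := compSetoid K H G V U) ⟨h, ?_⟩).symm
  simp [smul_smul, ← Prod.one_eq_mk]

def Comp.lift {α : Type} (f : V → U → α)
    (hf : ∀ (h : H) v u, f (((1, op h) : K × Hᵐᵒᵖ) • v) u = f v (((h, 1) : H × Gᵐᵒᵖ) • u))
    (x : Comp K H G V U) : α :=
  Quotient.lift (s := compSetoid K H G V U) (fun p => f p.1 p.2) (by
    rintro p q ⟨h, rfl⟩
    simp only [hf, smul_smul]
    simp [← Prod.one_eq_mk]) x

@[simp]
theorem Comp.lift_mk {α : Type} (f : V → U → α)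
    (hf : ∀ (h : H) v u, f (((1, op h) : K × Hᵐᵒᵖ) • v) u = f v (((h, 1) : H × Gᵐᵒᵖ) • u))
    (v : V) (u : U) : Comp.lift f hf (Comp.mk K H G v u) = f v u := rfl

instance : MulAction (K × Gᵐᵒᵖ) (Comp K H G V U) where
  smul p := Comp.lift
    (fun v u => Comp.mk K H G (((p.1, 1) : K × Hᵐᵒᵖ) • v) (((1, p.2) : H × Gᵐᵒᵖ) • u)) (by
      intro h v u
      rw [left_right_comm, Comp.mk_right_left, left_right_comm])
  one_smul x := by
    induction x using Comp.ind with | h v u =>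
    change Comp.mk K H G (((1, 1) : K × Hᵐᵒᵖ) • v) (((1, 1) : H × Gᵐᵒᵖ) • u) = _
    simp [← Prod.one_eq_mk]
  mul_smul p q x := by
    induction x using Comp.ind with | h v u =>
    change Comp.mk K H G (((p.1 * q.1, 1) : K × Hᵐᵒᵖ) • v) (((1, p.2 * q.2) : H × Gᵐᵒᵖ) • u) =
      Comp.mk K H G (((p.1, 1) : K × Hᵐᵒᵖ) • ((q.1, 1) : K × Hᵐᵒᵖ) • v)
        (((1, p.2) : H × Gᵐᵒᵖ) • ((1, q.2) : H × Gᵐᵒᵖ) • u)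
    simp [smul_smul]

theorem Comp.smul_mk (k : K) (g : Gᵐᵒᵖ) (v : V) (u : U) :
    ((k, g) : K × Gᵐᵒᵖ) • Comp.mk K H G v u =
      Comp.mk K H G (((k, 1) : K × Hᵐᵒᵖ) • v) (((1, g) : H × Gᵐᵒᵖ) • u) := rfl

end Comp

section Tens

variable (U X : Type) [MulAction (H × Gᵐᵒᵖ) U] [MulAction G X]

/-- The orbit relation of `G` acting on the right on `U × X` by `(u, x) g = (u g, g⁻¹ x)`. -/
def tensSetoid : Setoid (U × X) where
  r p q := ∃ g : G, q = (((1, op g) : H × Gᵐᵒᵖ) • p.1, g⁻¹ • p.2)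
  iseqv :=
    { refl := fun p => ⟨1, by
        have h1 : ((1, op 1) : H × Gᵐᵒᵖ) = 1 := rfl
        rw [h1, inv_one, one_smul, one_smul]⟩
      symm := by
        rintro p q ⟨h, rfl⟩
        refine ⟨h⁻¹, ?_⟩
        simp [smul_smul, ← Prod.one_eq_mk]
      trans := by
        rintro p q r ⟨h, rfl⟩ ⟨h', rfl⟩
        refine ⟨h * h', ?_⟩
        simp [smul_smul] }

/-- The `H`-set `U ×_G X = (U × X) / G`, for an `(H, G)`-biset `U` and a `G`-set `X`. -/
def Tens : Type := Quotient (tensSetoid H G U X)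

instance [Finite U] [Finite X] : Finite (Tens H G U X) :=
  inferInstanceAs (Finite (Quotient (tensSetoid H G U X)))

variable {U X}

def Tens.mk (u : U) (x : X) : Tens H G U X := Quotient.mk (tensSetoid H G U X) (u, x)

variable {H G}

theorem Tens.ind {P : Tens H G U X → Prop} (h : ∀ u x, P (Tens.mk H G u x))
    (x : Tens H G U X) : P x :=
  Quotient.inductionOn (s := tensSetoid H G U X) x fun p => h p.1 p.2

theorem Tens.mk_right_left (g : G) (u : U) (x : X) :
    Tens.mk H G (((1, op g) : H × Gᵐᵒᵖ) • u) x = Tens.mk H G u (g • x) := by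
  refine (Quotient.sound (s := tensSetoid H G U X) ⟨g, ?_⟩).symm
  simp [smul_smul]

def Tens.lift {α : Type} (f : U → X → α)
    (hf : ∀ (g : G) u x, f (((1, op g) : H × Gᵐᵒᵖ) • u) x = f u (g • x))
    (x : Tens H G U X) : α :=
  Quotient.lift (s := tensSetoid H G U X) (fun p => f p.1 p.2) (by
    rintro p q ⟨h, rfl⟩
    simp only [hf, smul_smul]
    simp) x

@[simp]
theorem Tens.lift_mk {α : Type} (f : U → X → α)
    (hf : ∀ (g : G) u x, f (((1, op g) : H × Gᵐᵒᵖ) • u) x = f u (g • x))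
    (u : U) (x : X) : Tens.lift f hf (Tens.mk H G u x) = f u x := rfl

instance : MulAction H (Tens H G U X) where
  smul h := Tens.lift (fun u x => Tens.mk H G (((h, 1) : H × Gᵐᵒᵖ) • u) x) (by
      intro g u x
      rw [left_right_comm, Tens.mk_right_left])
  one_smul x := by
    induction x using Tens.ind with | h v u =>
    change Tens.mk H G (((1, 1) : H × Gᵐᵒᵖ) • v) u = _
    simp [← Prod.one_eq_mk]
  mul_smul p q x := by
    induction x using Tens.ind with | h v u =>
    change Tens.mk H G (((p * q, 1) : H × Gᵐᵒᵖ) • v) u =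
      Tens.mk H G (((p, 1) : H × Gᵐᵒᵖ) • ((q, 1) : H × Gᵐᵒᵖ) • v) u
    simp [smul_smul]

theorem Tens.smul_mk (h : H) (u : U) (x : X) :
    h • Tens.mk H G u x = Tens.mk H G (((h, 1) : H × Gᵐᵒᵖ) • u) x := rfl

end Tens

end Bisets

/-! ### Operations on isomorphism classes -/

section Classes

variable {K H G F : Type} [Group K] [Group H] [Group G] [Group F]

open GSetClass

/-- The opposite of (the class of) a biset, as an additive map. -/
def opClass : BisetClass H G →+ BisetClass G H where
  toFun := lift (fun U _ _ => GSetClass.mk (G × Hᵐᵒᵖ) (OpBiset H G U))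
    (fun U U' _ _ _ _ ⟨e, he⟩ => mk_eq_mk
      ((OpBiset.equiv H G U).trans (e.trans (OpBiset.equiv H G U').symm))
      (fun g u => OpBiset.ext (he _ u.val)))
  map_zero' := by
    rw [zero_def, lift_mk]
    exact mk_eq_mk (OpBiset.equiv H G Empty) (fun g u => u.val.elim)
  map_add' a b := by
    induction a using GSetClass.ind with | h U =>
    induction b using GSetClass.ind with | h V =>
    simp only [mk_add, lift_mk]
    refine mk_eq_mk ((OpBiset.equiv H G (U ⊕ V)).trans
      (Equiv.sumCongr (OpBiset.equiv H G U).symm (OpBiset.equiv H G V).symm)) ?_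
    rintro g ⟨u | v⟩ <;> rfl

theorem opClass_mk (U : Type) [Finite U] [MulAction (H × Gᵐᵒᵖ) U] :
    opClass (GSetClass.mk (H × Gᵐᵒᵖ) U) = GSetClass.mk (G × Hᵐᵒᵖ) (OpBiset H G U) := by
  simp only [opClass, AddMonoidHom.coe_mk, ZeroHom.coe_mk, lift_mk]

variable (G) in
/-- The class of the identity biset. -/
def idClass [Finite G] : BisetClass G G := GSetClass.mk (G × Gᵐᵒᵖ) (IdBiset G)

theorem comp_congr {V V' U U' : Type} [MulAction (K × Hᵐᵒᵖ) V] [MulAction (K × Hᵐᵒᵖ) V']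
    [MulAction (H × Gᵐᵒᵖ) U] [MulAction (H × Gᵐᵒᵖ) U'] (h : GIso (K × Hᵐᵒᵖ) V V')
    (h' : GIso (H × Gᵐᵒᵖ) U U') : GIso (K × Gᵐᵒᵖ) (Comp K H G V U) (Comp K H G V' U') := by
  obtain ⟨e, he⟩ := h
  obtain ⟨f, hf⟩ := h'
  have he' : ∀ g v, e.symm (g • v) = g • e.symm v := fun g v => by
    rw [Equiv.symm_apply_eq, he, Equiv.apply_symm_apply]
  have hf' : ∀ g v, f.symm (g • v) = g • f.symm v := fun g v => by
    rw [Equiv.symm_apply_eq, hf, Equiv.apply_symm_apply]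
  refine ⟨⟨Comp.lift (fun v u => Comp.mk K H G (e v) (f u)) ?_,
    Comp.lift (fun v u => Comp.mk K H G (e.symm v) (f.symm u)) ?_, ?_, ?_⟩, ?_⟩
  · intro h v u
    rw [he, hf, Comp.mk_right_left]
  · intro h v u
    rw [he', hf', Comp.mk_right_left]
  · intro x
    induction x using Comp.ind with | h v u => simp
  · intro x
    induction x using Comp.ind with | h v u => simp
  · rintro ⟨k, g⟩ x
    induction x using Comp.ind with | h v u =>
    simp [Comp.smul_mk, he, hf]

theorem tens_congr {U U' X X' : Type} [MulAction (H × Gᵐᵒᵖ) U] [MulAction (H × Gᵐᵒᵖ) U']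
    [MulAction G X] [MulAction G X'] (h : GIso (H × Gᵐᵒᵖ) U U')
    (h' : GIso G X X') : GIso H (Tens H G U X) (Tens H G U' X') := by
  obtain ⟨e, he⟩ := h
  obtain ⟨f, hf⟩ := h'
  have he' : ∀ g v, e.symm (g • v) = g • e.symm v := fun g v => by
    rw [Equiv.symm_apply_eq, he, Equiv.apply_symm_apply]
  have hf' : ∀ g v, f.symm (g • v) = g • f.symm v := fun g v => by
    rw [Equiv.symm_apply_eq, hf, Equiv.apply_symm_apply]
  refine ⟨⟨Tens.lift (fun v u => Tens.mk H G (e v) (f u)) ?_,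
    Tens.lift (fun v u => Tens.mk H G (e.symm v) (f.symm u)) ?_, ?_, ?_⟩, ?_⟩
  · intro h v u
    rw [he, hf, Tens.mk_right_left]
  · intro h v u
    rw [he', hf', Tens.mk_right_left]
  · intro x
    induction x using Tens.ind with | h v u => simp
  · intro x
    induction x using Tens.ind with | h v u => simp
  · rintro g x
    induction x using Tens.ind with | h v u =>
    simp [Tens.smul_mk, he]

/-- Composition on classes of bisets, as a function. -/
def compFun (b : BisetClass K H) (a : BisetClass H G) : BisetClass K G :=
  lift (fun V _ _ => lift (fun U _ _ => GSetClass.mk (K × Gᵐᵒᵖ) (Comp K H G V U))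
    (fun U U' _ _ _ _ h => mk_eq_mk_iff.2 (comp_congr (GIso.refl V) h)) a)
    (fun V V' _ _ _ _ h => by
      induction a using GSetClass.ind with | h U =>
      rw [lift_mk, lift_mk]
      exact mk_eq_mk_iff.2 (comp_congr h (GIso.refl U))) b

theorem compFun_mk (V U : Type) [Finite V] [Finite U] [MulAction (K × Hᵐᵒᵖ) V]
    [MulAction (H × Gᵐᵒᵖ) U] :
    compFun (GSetClass.mk (K × Hᵐᵒᵖ) V) (GSetClass.mk (H × Gᵐᵒᵖ) U) =
      GSetClass.mk (K × Gᵐᵒᵖ) (Comp K H G V U) := by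
  rw [compFun, lift_mk, lift_mk]

/-- The action of classes of bisets on classes of sets, as a function. -/
def actFun (b : BisetClass H G) (a : GSetClass G) : GSetClass H :=
  lift (fun U _ _ => lift (fun X _ _ => GSetClass.mk H (Tens H G U X))
    (fun X X' _ _ _ _ h => mk_eq_mk_iff.2 (tens_congr (GIso.refl U) h)) a)
    (fun U U' _ _ _ _ h => by
      induction a using GSetClass.ind with | h X =>
      rw [lift_mk, lift_mk]
      exact mk_eq_mk_iff.2 (tens_congr h (GIso.refl X))) b

theorem actFun_mk (U X : Type) [Finite U] [Finite X] [MulAction (H × Gᵐᵒᵖ) U]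
    [MulAction G X] :
    actFun (GSetClass.mk (H × Gᵐᵒᵖ) U) (GSetClass.mk G X) = GSetClass.mk H (Tens H G U X) := by
  rw [actFun, lift_mk, lift_mk]

/-! Distributivity and associativity of these operations. -/

theorem compFun_add_left (b b' : BisetClass K H) (a : BisetClass H G) :
    compFun (b + b') a = compFun b a + compFun b' a := by
  induction b using GSetClass.ind with | h V =>
  induction b' using GSetClass.ind with | h V' =>
  induction a using GSetClass.ind with | h U =>
  simp only [mk_add, compFun_mk]
  refine mk_eq_mk ⟨Comp.lift (fun v u => Sum.elim (fun v => Sum.inl (Comp.mk K H G v u))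
      (fun v => Sum.inr (Comp.mk K H G v u)) v) ?_,
    Sum.elim (Comp.lift (fun v u => Comp.mk K H G (Sum.inl v) u) ?_)
      (Comp.lift (fun v u => Comp.mk K H G (Sum.inr v) u) ?_), ?_, ?_⟩ ?_
  · rintro h (v | v) u <;> simp [Comp.mk_right_left]
  · intro h v u
    rw [← Comp.mk_right_left, Sum.smul_inl]
  · intro h v u
    rw [← Comp.mk_right_left, Sum.smul_inr]
  · intro x
    induction x using Comp.ind with | h v u => rcases v with v | v <;> rfl
  · rintro (x | x) <;> induction x using Comp.ind with | h v u => rfl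
  · rintro ⟨k, g⟩ x
    induction x using Comp.ind with | h v u => rcases v with v | v <;> rfl

theorem compFun_add_right (b : BisetClass K H) (a a' : BisetClass H G) :
    compFun b (a + a') = compFun b a + compFun b a' := by
  induction b using GSetClass.ind with | h V =>
  induction a using GSetClass.ind with | h U =>
  induction a' using GSetClass.ind with | h U' =>
  simp only [mk_add, compFun_mk]
  refine mk_eq_mk ⟨Comp.lift (fun v u => Sum.elim (fun u => Sum.inl (Comp.mk K H G v u))
      (fun u => Sum.inr (Comp.mk K H G v u)) u) ?_,
    Sum.elim (Comp.lift (fun v u => Comp.mk K H G v (Sum.inl u)) ?_)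
      (Comp.lift (fun v u => Comp.mk K H G v (Sum.inr u)) ?_), ?_, ?_⟩ ?_
  · rintro h v (u | u) <;> simp [Comp.mk_right_left]
  · intro h v u
    rw [Comp.mk_right_left, Sum.smul_inl]
  · intro h v u
    rw [Comp.mk_right_left, Sum.smul_inr]
  · intro x
    induction x using Comp.ind with | h v u => rcases u with u | u <;> rfl
  · rintro (x | x) <;> induction x using Comp.ind with | h v u => rfl
  · rintro ⟨k, g⟩ x
    induction x using Comp.ind with | h v u => rcases u with u | u <;> rfl

theorem compFun_zero_left (a : BisetClass H G) : compFun (0 : BisetClass K H) a = 0 := by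
  induction a using GSetClass.ind with | h U =>
  simp only [zero_def, compFun_mk]
  have : IsEmpty (Comp K H G Empty U) := ⟨fun x => Comp.ind (P := fun _ => False) (fun v _ => v.elim) x⟩
  exact mk_eq_mk (Equiv.equivOfIsEmpty _ _) (fun g x => isEmptyElim x)

theorem compFun_zero_right (b : BisetClass K H) : compFun b (0 : BisetClass H G) = 0 := by
  induction b using GSetClass.ind with | h U =>
  simp only [zero_def, compFun_mk]
  have : IsEmpty (Comp K H G U Empty) := ⟨fun x => Comp.ind (P := fun _ => False) (fun _ v => v.elim) x⟩
  exact mk_eq_mk (Equiv.equivOfIsEmpty _ _) (fun g x => isEmptyElim x)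

theorem actFun_add_left (b b' : BisetClass H G) (a : GSetClass G) :
    actFun (b + b') a = actFun b a + actFun b' a := by
  induction b using GSetClass.ind with | h V =>
  induction b' using GSetClass.ind with | h V' =>
  induction a using GSetClass.ind with | h X =>
  simp only [mk_add, actFun_mk]
  refine mk_eq_mk ⟨Tens.lift (fun v u => Sum.elim (fun v => Sum.inl (Tens.mk H G v u))
      (fun v => Sum.inr (Tens.mk H G v u)) v) ?_,
    Sum.elim (Tens.lift (fun v u => Tens.mk H G (Sum.inl v) u) ?_)
      (Tens.lift (fun v u => Tens.mk H G (Sum.inr v) u) ?_), ?_, ?_⟩ ?_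
  · rintro h (v | v) u <;> simp [Tens.mk_right_left]
  · intro h v u
    rw [← Tens.mk_right_left, Sum.smul_inl]
  · intro h v u
    rw [← Tens.mk_right_left, Sum.smul_inr]
  · intro x
    induction x using Tens.ind with | h v u => rcases v with v | v <;> rfl
  · rintro (x | x) <;> induction x using Tens.ind with | h v u => rfl
  · rintro g x
    induction x using Tens.ind with | h v u => rcases v with v | v <;> rfl

theorem actFun_add_right (b : BisetClass H G) (a a' : GSetClass G) :
    actFun b (a + a') = actFun b a + actFun b a' := by
  induction b using GSetClass.ind with | h V =>
  induction a using GSetClass.ind with | h U =>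
  induction a' using GSetClass.ind with | h U' =>
  simp only [mk_add, actFun_mk]
  refine mk_eq_mk ⟨Tens.lift (fun v u => Sum.elim (fun u => Sum.inl (Tens.mk H G v u))
      (fun u => Sum.inr (Tens.mk H G v u)) u) ?_,
    Sum.elim (Tens.lift (fun v u => Tens.mk H G v (Sum.inl u)) ?_)
      (Tens.lift (fun v u => Tens.mk H G v (Sum.inr u)) ?_), ?_, ?_⟩ ?_
  · rintro h v (u | u) <;> simp [Tens.mk_right_left]
  · intro h v u
    rw [Tens.mk_right_left, Sum.smul_inl]
  · intro h v u
    rw [Tens.mk_right_left, Sum.smul_inr]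
  · intro x
    induction x using Tens.ind with | h v u => rcases u with u | u <;> rfl
  · rintro (x | x) <;> induction x using Tens.ind with | h v u => rfl
  · rintro g x
    induction x using Tens.ind with | h v u => rcases u with u | u <;> rfl

theorem actFun_zero_left (a : GSetClass G) : actFun (0 : BisetClass H G) a = 0 := by
  induction a using GSetClass.ind with | h U =>
  simp only [zero_def, actFun_mk]
  have : IsEmpty (Tens H G Empty U) := ⟨fun x => Tens.ind (P := fun _ => False) (fun v _ => v.elim) x⟩
  exact mk_eq_mk (Equiv.equivOfIsEmpty _ _) (fun g x => isEmptyElim x)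

theorem actFun_zero_right (b : BisetClass H G) : actFun b (0 : GSetClass G) = 0 := by
  induction b using GSetClass.ind with | h U =>
  simp only [zero_def, actFun_mk]
  have : IsEmpty (Tens H G U Empty) := ⟨fun x => Tens.ind (P := fun _ => False) (fun _ v => v.elim) x⟩
  exact mk_eq_mk (Equiv.equivOfIsEmpty _ _) (fun g x => isEmptyElim x)

/-- Composition of bisets, as a biadditive map on isomorphism classes. -/
def compClass : BisetClass K H →+ BisetClass H G →+ BisetClass K G where
  toFun b :=
    { toFun := compFun b
      map_zero' := compFun_zero_right b
      map_add' := compFun_add_right b }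
  map_zero' := by
    ext a
    exact compFun_zero_left a
  map_add' b b' := by
    ext a
    exact compFun_add_left b b' a

/-- The action of bisets on sets, as a biadditive map on isomorphism classes. -/
def actClass : BisetClass H G →+ GSetClass G →+ GSetClass H where
  toFun b :=
    { toFun := actFun b
      map_zero' := actFun_zero_right b
      map_add' := actFun_add_right b }
  map_zero' := by
    ext a
    exact actFun_zero_left a
  map_add' b b' := by
    ext a
    exact actFun_add_left b b' a

theorem compClass_mk (V U : Type) [Finite V] [Finite U] [MulAction (K × Hᵐᵒᵖ) V]
    [MulAction (H × Gᵐᵒᵖ) U] :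
    compClass (GSetClass.mk (K × Hᵐᵒᵖ) V) (GSetClass.mk (H × Gᵐᵒᵖ) U) =
      GSetClass.mk (K × Gᵐᵒᵖ) (Comp K H G V U) := compFun_mk V U

theorem actClass_mk (U X : Type) [Finite U] [Finite X] [MulAction (H × Gᵐᵒᵖ) U]
    [MulAction G X] :
    actClass (GSetClass.mk (H × Gᵐᵒᵖ) U) (GSetClass.mk G X) = GSetClass.mk H (Tens H G U X) :=
  actFun_mk U X

theorem compClass_assoc (c : BisetClass F K) (b : BisetClass K H) (a : BisetClass H G) :
    compClass (compClass c b) a = compClass c (compClass b a) := by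
  induction c using GSetClass.ind with | h W =>
  induction b using GSetClass.ind with | h V =>
  induction a using GSetClass.ind with | h U =>
  simp only [compClass_mk]
  refine mk_eq_mk ⟨Comp.lift (fun x u => Comp.lift
      (fun w v => Comp.mk F K G w (Comp.mk K H G v u)) ?_ x) ?_,
    Comp.lift (fun w x => Comp.lift (fun v u => Comp.mk F H G (Comp.mk F K H w v) u) ?_ x) ?_,
    ?_, ?_⟩ ?_
  · intro h w v
    rw [Comp.mk_right_left, Comp.smul_mk, ← Prod.one_eq_mk, one_smul]
  · intro h x u
    induction x using Comp.ind with | h w v =>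
    rw [Comp.smul_mk, Comp.lift_mk, Comp.lift_mk, Comp.mk_right_left, ← Prod.one_eq_mk, one_smul]
  · intro h v u
    rw [← Comp.mk_right_left, Comp.smul_mk, ← Prod.one_eq_mk, one_smul]
  · intro h w x
    induction x using Comp.ind with | h v u =>
    rw [Comp.smul_mk, Comp.lift_mk, Comp.lift_mk, Comp.mk_right_left, ← Prod.one_eq_mk, one_smul]
  · intro x
    induction x using Comp.ind with | h x u =>
    induction x using Comp.ind with | h w v => rfl
  · intro x
    induction x using Comp.ind with | h w x =>
    induction x using Comp.ind with | h v u => rfl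
  · rintro ⟨f, g⟩ x
    induction x using Comp.ind with | h x u =>
    induction x using Comp.ind with | h w v =>
    change Comp.mk F K G (((f, 1) : F × Kᵐᵒᵖ) • w) (Comp.mk K H G (((1, 1) : K × Hᵐᵒᵖ) • v)
      (((1, g) : H × Gᵐᵒᵖ) • u)) = Comp.mk F K G (((f, 1) : F × Kᵐᵒᵖ) • w)
      (Comp.mk K H G (((1, 1) : K × Hᵐᵒᵖ) • v) (((1, g) : H × Gᵐᵒᵖ) • u))
    rfl

theorem actClass_comp (c : BisetClass K H) (b : BisetClass H G) (a : GSetClass G) :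
    actClass (compClass c b) a = actClass c (actClass b a) := by
  induction c using GSetClass.ind with | h V =>
  induction b using GSetClass.ind with | h U =>
  induction a using GSetClass.ind with | h X =>
  simp only [compClass_mk, actClass_mk]
  refine mk_eq_mk ⟨Tens.lift (fun y x => Comp.lift
      (fun v u => Tens.mk K H v (Tens.mk H G u x)) ?_ y) ?_,
    Tens.lift (fun v y => Tens.lift (fun u x => Tens.mk K G (Comp.mk K H G v u) x) ?_ y) ?_,
    ?_, ?_⟩ ?_
  · intro h w v
    rw [Tens.mk_right_left, Tens.smul_mk]
  · intro h x u
    induction x using Comp.ind with | h w v =>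
    rw [Comp.smul_mk, Comp.lift_mk, Comp.lift_mk, Tens.mk_right_left, ← Prod.one_eq_mk, one_smul]
  · intro h v u
    rw [← Tens.mk_right_left, Comp.smul_mk, ← Prod.one_eq_mk, one_smul]
  · intro h w x
    induction x using Tens.ind with | h v u =>
    rw [Tens.smul_mk, Tens.lift_mk, Tens.lift_mk, Comp.mk_right_left]
  · intro x
    induction x using Tens.ind with | h x u =>
    induction x using Comp.ind with | h w v => rfl
  · intro x
    induction x using Tens.ind with | h w x =>
    induction x using Tens.ind with | h v u => rfl
  · rintro f x
    induction x using Tens.ind with | h x u =>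
    induction x using Comp.ind with | h w v =>
    change Tens.mk K H (((f, 1) : K × Hᵐᵒᵖ) • w) (Tens.mk H G (((1, 1) : H × Gᵐᵒᵖ) • v) u) =
      Tens.mk K H (((f, 1) : K × Hᵐᵒᵖ) • w) (Tens.mk H G v u)
    rw [← Prod.one_eq_mk, one_smul]

theorem compClass_id_left [Finite H] (a : BisetClass H G) : compClass (idClass H) a = a := by
  induction a using GSetClass.ind with | h U =>
  rw [idClass, compClass_mk]
  refine mk_eq_mk ⟨Comp.lift (fun (h : IdBiset H) u => ((h.val, 1) : H × Gᵐᵒᵖ) • u) ?_,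
    fun u => Comp.mk H H G ⟨1⟩ u, ?_, ?_⟩ ?_
  · intro h x u
    simp [smul_smul, idBiset_smul]
  · intro x
    induction x using Comp.ind with | h v u =>
    simp [← Comp.mk_right_left, idBiset_smul]
  · intro u
    simp [← Prod.one_eq_mk]
  · rintro ⟨h, g⟩ x
    induction x using Comp.ind with | h v u =>
    simp [Comp.smul_mk, smul_smul, idBiset_smul]

theorem compClass_id_right [Finite G] (a : BisetClass H G) : compClass a (idClass G) = a := by
  induction a using GSetClass.ind with | h U =>
  rw [idClass, compClass_mk]
  refine mk_eq_mk ⟨Comp.lift (fun u (g : IdBiset G) => ((1, op g.val) : H × Gᵐᵒᵖ) • u) ?_,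
    fun u => Comp.mk H G G u ⟨1⟩, ?_, ?_⟩ ?_
  · intro h u x
    simp [smul_smul, idBiset_smul]
  · intro x
    induction x using Comp.ind with | h v u =>
    simp [Comp.mk_right_left, idBiset_smul]
  · intro u
    simp [← Prod.one_eq_mk]
  · rintro ⟨h, g⟩ x
    induction x using Comp.ind with | h v u =>
    simp [Comp.smul_mk, smul_smul, idBiset_smul]

theorem actClass_id [Finite G] (a : GSetClass G) : actClass (idClass G) a = a := by
  induction a using GSetClass.ind with | h X =>
  rw [idClass, actClass_mk]
  refine mk_eq_mk ⟨Tens.lift (fun (g : IdBiset G) x => g.val • x) ?_,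
    fun u => Tens.mk G G ⟨1⟩ u, ?_, ?_⟩ ?_
  · intro h u x
    simp [smul_smul, idBiset_smul]
  · intro x
    induction x using Tens.ind with | h v u =>
    simp [← Tens.mk_right_left, idBiset_smul]
  · intro u
    simp
  · rintro g x
    induction x using Tens.ind with | h v u =>
    simp [Tens.smul_mk, smul_smul, idBiset_smul]

theorem opClass_id [Finite G] : opClass (idClass G) = idClass G := by
  rw [idClass, opClass_mk]
  refine mk_eq_mk ((OpBiset.equiv G G _).trans ((IdBiset.equiv G).trans
    ((Equiv.inv G).trans (IdBiset.equiv G).symm))) ?_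
  rintro ⟨g, h⟩ ⟨⟨x⟩⟩
  ext
  change (h.unop⁻¹ * x * g⁻¹)⁻¹ = g * x⁻¹ * h.unop
  simp [mul_assoc]

theorem opClass_opClass (a : BisetClass H G) : opClass (opClass a) = a := by
  induction a using GSetClass.ind with | h U =>
  rw [opClass_mk, opClass_mk]
  refine mk_eq_mk ((OpBiset.equiv G H _).trans (OpBiset.equiv H G U)) ?_
  rintro ⟨h, g⟩ ⟨⟨u⟩⟩
  simp [OpBiset.equiv, opBiset_smul]

theorem opClass_comp (b : BisetClass K H) (a : BisetClass H G) :
    opClass (compClass b a) = compClass (opClass a) (opClass b) := by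
  induction b using GSetClass.ind with | h V =>
  induction a using GSetClass.ind with | h U =>
  simp only [compClass_mk, opClass_mk]
  refine mk_eq_mk ((OpBiset.equiv K G (Comp K H G V U)).trans
    ⟨Comp.lift (fun v u => Comp.mk G H K ⟨u⟩ ⟨v⟩) ?_,
      Comp.lift (fun u v => Comp.mk K H G v.val u.val) ?_, ?_, ?_⟩) ?_
  · intro h v u
    have := Comp.mk_right_left (K := G) (G := K) h⁻¹ (⟨u⟩ : OpBiset H G U) (⟨v⟩ : OpBiset K H V)
    simpa [opBiset_smul] using this.symm
  · intro h u v
    have := Comp.mk_right_left (K := K) (G := G) h⁻¹ v.val u.val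
    simpa [opBiset_smul] using this.symm
  · intro x
    induction x using Comp.ind with | h v u => rfl
  · intro x
    induction x using Comp.ind with | h v u => rfl
  · rintro ⟨g, k⟩ ⟨x⟩
    induction x using Comp.ind with | h v u =>
    simp [OpBiset.equiv, opBiset_smul, Comp.smul_mk]

end Classes


/-! ### Marks -/

section Marks

variable {G : Type} [Group G]

/-- The set `X ^ K` of fixed points of a subgroup `K`. -/
abbrev Fix (K : Subgroup G) (X : Type) [MulAction G X] : Type := {x : X // ∀ k ∈ K, k • x = x}

/-- The number of `K`-fixed points, as a homomorphism of semirings. -/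
def fixCard (K : Subgroup G) : GSetClass G →+* ℕ where
  toFun := GSetClass.lift (fun X _ _ => Nat.card (Fix K X)) (fun X Y _ _ _ _ ⟨e, he⟩ =>
    Nat.card_congr (e.subtypeEquiv fun x => by simp [← he]))
  map_one' := by
    rw [GSetClass.one_def, GSetClass.lift_mk]
    have : Unique (Fix K Unit) := ⟨⟨⟨(), fun _ _ => rfl⟩⟩, fun _ => rfl⟩
    exact Nat.card_unique
  map_zero' := by
    rw [GSetClass.zero_def, GSetClass.lift_mk]
    simp
  map_add' a b := by
    induction a using GSetClass.ind with | h X =>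
    induction b using GSetClass.ind with | h Y =>
    simp only [GSetClass.mk_add, GSetClass.lift_mk]
    rw [← Nat.card_sum]
    refine Nat.card_congr (Equiv.subtypeSum.trans (Equiv.sumCongr ?_ ?_))
    · exact Equiv.subtypeEquivRight (by simp)
    · exact Equiv.subtypeEquivRight (by simp)
  map_mul' a b := by
    induction a using GSetClass.ind with | h X =>
    induction b using GSetClass.ind with | h Y =>
    simp only [GSetClass.mk_mul, GSetClass.lift_mk]
    rw [← Nat.card_prod]
    refine Nat.card_congr ((Equiv.subtypeEquivRight ?_).trans
      (Equiv.subtypeProdEquivProd (p := fun x : X => ∀ k ∈ K, k • x = x)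
        (q := fun y : Y => ∀ k ∈ K, k • y = y)))
    rintro ⟨x, y⟩
    simp only [Prod.smul_mk, Prod.mk.injEq]
    exact ⟨fun h => ⟨fun k hk => (h k hk).1, fun k hk => (h k hk).2⟩,
      fun h k hk => ⟨h.1 k hk, h.2 k hk⟩⟩

theorem fixCard_mk (K : Subgroup G) (X : Type) [Finite X] [MulAction G X] :
    fixCard K (GSetClass.mk G X) = Nat.card (Fix K X) := by
  simp only [fixCard, RingHom.coe_mk, MonoidHom.coe_mk, OneHom.coe_mk, GSetClass.lift_mk]

/-- The ring homomorphism `B(G) → ℤ`, `a ↦ |a ^ K|`, extending `[X] ↦ |X ^ K|`. -/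
def mark (K : Subgroup G) : Burnside G →+* ℤ :=
  Gro.liftRing ((Nat.castRingHom ℤ).comp (fixCard K))

theorem mark_of (K : Subgroup G) (x : GSetClass G) : mark K (Gro.of x) = fixCard K x := by
  simp [mark]

theorem mark_cls (K : Subgroup G) (X : Type) [Finite X] [MulAction G X] :
    mark K (cls G X) = Nat.card (Fix K X) := by
  rw [cls, mark_of, fixCard_mk]

/-- `∏ |a ^ (G_y)|`, where `y` runs through representatives of the orbits of `G` on `Y` and `G_y`
is the stabilizer of `y`; for `a = [X]`, this is the number of `G`-maps from `Y` to `X`. -/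
def orbitProd (Y : Type) [Finite Y] [MulAction G Y] : Burnside G →* ℤ where
  toFun a := ∏ᶠ ω : MulAction.orbitRel.Quotient G Y, mark (MulAction.stabilizer G ω.out) a
  map_one' := by simp
  map_mul' a b := by
    simp only [map_mul]
    exact finprod_mul_distrib (Set.toFinite _) (Set.toFinite _)

theorem orbitProd_apply (Y : Type) [Finite Y] [MulAction G Y] (a : Burnside G) :
    orbitProd Y a =
      ∏ᶠ ω : MulAction.orbitRel.Quotient G Y, mark (MulAction.stabilizer G ω.out) a := rfl

theorem orbitProd_cls (Y X : Type) [Finite Y] [Finite X] [MulAction G Y] [MulAction G X] :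
    orbitProd Y (cls G X) = Nat.card (Y →[G] X) := by
  let _ := Fintype.ofFinite (MulAction.orbitRel.Quotient G Y)
  rw [orbitProd_apply, finprod_eq_prod_of_fintype]
  simp only [mark_cls]
  rw [← Nat.cast_prod, ← Nat.card_pi]
  congr 1
  refine (Nat.card_eq_of_bijective (fun (f : Y →[G] X) (ω : MulAction.orbitRel.Quotient G Y) =>
    (⟨f ω.out, fun k hk => by rw [← map_smul, MulAction.mem_stabilizer_iff.1 hk]⟩ :
      Fix (MulAction.stabilizer G ω.out) X)) ⟨?_, ?_⟩).symm
  · intro f f' h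
    ext y
    obtain ⟨g, hg⟩ : ∃ g : G, g • (Quotient.mk (MulAction.orbitRel G Y) y).out = y :=
      (MulAction.orbitRel G Y).symm (Quotient.mk_out (s := MulAction.orbitRel G Y) y)
    have h1 := congrArg Subtype.val (congrFun h (Quotient.mk (MulAction.orbitRel G Y) y))
    rw [← hg, map_smul, map_smul]
    exact congrArg (g • ·) h1
  · intro s
    have hex : ∀ y : Y, ∃ g : G, g • (Quotient.mk (MulAction.orbitRel G Y) y).out = y := fun y =>
      (MulAction.orbitRel G Y).symm (Quotient.mk_out (s := MulAction.orbitRel G Y) y)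
    choose c hc using hex
    have key : ∀ (ω : MulAction.orbitRel.Quotient G Y) (g : G) (y : Y), g • ω.out = y →
        c y • (s (Quotient.mk (MulAction.orbitRel G Y) y)).1 = g • (s ω).1 := by
      intro ω g y hy
      have hω : ω = Quotient.mk (MulAction.orbitRel G Y) y := by
        rw [← Quotient.out_eq (s := MulAction.orbitRel G Y) ω]
        exact (Quotient.sound (s := MulAction.orbitRel G Y)
          (show y ∈ MulAction.orbit G ω.out from ⟨g, hy⟩)).symm
      subst hω
      have h1 : g⁻¹ * c y ∈
          MulAction.stabilizer G (Quotient.mk (MulAction.orbitRel G Y) y).out := by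
        rw [MulAction.mem_stabilizer_iff, mul_smul, hc, inv_smul_eq_iff, hy]
      have h2 := (s (Quotient.mk (MulAction.orbitRel G Y) y)).2 _ h1
      rw [mul_smul, inv_smul_eq_iff] at h2
      exact h2
    refine ⟨⟨fun y => c y • (s (Quotient.mk (MulAction.orbitRel G Y) y)).1, ?_⟩, ?_⟩
    · intro g y
      rw [key (Quotient.mk (MulAction.orbitRel G Y) y) (g * c y) (g • y)
        (by rw [mul_smul, hc]), mul_smul]
      rfl
    · funext ω
      ext
      have := key ω 1 ω.out (one_smul _ _)
      rw [one_smul] at this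
      exact this

/-- A function that respects congruences modulo every integer. -/
def Congruent (f : Burnside G → ℤ) : Prop :=
  ∀ (M : ℤ) (a c : Burnside G), M ∣ f (a + M • c) - f a

theorem congruent_mark (K : Subgroup G) : Congruent (fun a => mark K a) := by
  intro M a c
  simp

theorem congruent_orbitProd (Y : Type) [Finite Y] [MulAction G Y] :
    Congruent (fun a : Burnside G => orbitProd Y a) := by
  intro M a c
  let _ := Fintype.ofFinite (MulAction.orbitRel.Quotient G Y)
  simp only [orbitProd_apply, finprod_eq_prod_of_fintype]
  refine Int.ModEq.dvd (Int.ModEq.prod fun ω _ => ?_)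
  refine (Int.modEq_iff_dvd).2 ?_
  exact congruent_mark _ M a c

theorem exists_of_congruent (M : ℕ) (hM : 0 < M) (a : Burnside G) :
    ∃ (x : GSetClass G) (c : Burnside G), Gro.of x = a + (M : ℤ) • c := by
  induction a using Gro.ind with | h x y =>
  obtain ⟨m, rfl⟩ : ∃ m, M = m + 1 := ⟨M - 1, by omega⟩
  refine ⟨x + m • y, Gro.of y, ?_⟩
  rw [map_add, map_nsmul]
  push_cast
  rw [add_smul, one_smul, natCast_zsmul]
  abel

theorem congruent_ext {f f' : Burnside G → ℤ} (hf : Congruent f) (hf' : Congruent f')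
    (h : ∀ (X : Type) [Finite X] [MulAction G X], f (cls G X) = f' (cls G X)) : f = f' := by
  funext a
  have h' : ∀ x : GSetClass G, f (Gro.of x) = f' (Gro.of x) := fun x => by
    induction x using GSetClass.ind with | h X => exact h X
  obtain ⟨x, c, hx⟩ := exists_of_congruent ((f' a - f a).natAbs + 1) (Nat.succ_pos _) a
  have h1 := hf (((f' a - f a).natAbs + 1 : ℕ) : ℤ) a c
  have h2 := hf' (((f' a - f a).natAbs + 1 : ℕ) : ℤ) a c
  rw [← hx] at h1 h2
  rw [h' x] at h1
  have h3 := dvd_sub h1 h2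
  have h4 : f' (Gro.of x) - f a - (f' (Gro.of x) - f' a) = f' a - f a := by ring
  rw [h4] at h3
  have h5 := Int.eq_zero_of_abs_lt_dvd h3 (by rw [Int.abs_eq_natAbs]; push_cast; omega)
  omega

theorem orbitProd_congr {Y Y' : Type} [Finite Y] [Finite Y'] [MulAction G Y] [MulAction G Y']
    (h : GIso G Y Y') : (orbitProd Y : Burnside G →* ℤ) = orbitProd Y' := by
  obtain ⟨e, he⟩ := h
  have he' : ∀ (g : G) y, e.symm (g • y) = g • e.symm y := fun g v => by
    rw [Equiv.symm_apply_eq, he, Equiv.apply_symm_apply]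
  refine DFunLike.coe_injective
    (congruent_ext (congruent_orbitProd Y) (congruent_orbitProd Y') ?_)
  intro X _ _
  rw [orbitProd_cls, orbitProd_cls]
  congr 1
  exact Nat.card_congr
    ⟨fun f => ⟨fun y => f (e.symm y), fun g y => by rw [he', map_smul]; rfl⟩,
      fun f => ⟨fun y => f (e y), fun g y => by rw [he, map_smul]; rfl⟩,
      fun f => MulActionHom.ext fun y => congrArg f (e.symm_apply_apply y),
      fun f => MulActionHom.ext fun y => congrArg f (e.apply_symm_apply y)⟩

/-- The invariant `orbitProd`, as a function of the isomorphism class. -/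
def orbitProdClass : GSetClass G → (Burnside G →* ℤ) :=
  GSetClass.lift (fun Y _ _ => orbitProd Y) (fun _ _ _ _ _ _ h => orbitProd_congr h)

theorem orbitProdClass_mk (Y : Type) [Finite Y] [MulAction G Y] :
    orbitProdClass (GSetClass.mk G Y) = orbitProd Y := GSetClass.lift_mk _ _ _

theorem orbitProdClass_add (y y' : GSetClass G) :
    orbitProdClass (y + y') = orbitProdClass y * orbitProdClass y' := by
  induction y using GSetClass.ind with | h Y =>
  induction y' using GSetClass.ind with | h Y' =>
  rw [GSetClass.mk_add, orbitProdClass_mk, orbitProdClass_mk, orbitProdClass_mk]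
  refine DFunLike.coe_injective
    (congruent_ext (congruent_orbitProd (Y ⊕ Y')) (f' := fun a => orbitProd Y a * orbitProd Y' a)
      ?_ ?_)
  · intro M a c
    exact ((Int.modEq_iff_dvd.2 (congruent_orbitProd Y M a c)).mul
      (Int.modEq_iff_dvd.2 (congruent_orbitProd Y' M a c))).dvd
  · intro X _ _
    rw [orbitProd_cls, orbitProd_cls, orbitProd_cls, ← Nat.cast_mul, ← Nat.card_prod]
    congr 1
    refine Nat.card_congr
      ⟨fun f => (⟨fun y => f (Sum.inl y), fun g y => by rw [← Sum.smul_inl, map_smul]; rfl⟩,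
          ⟨fun y => f (Sum.inr y), fun g y => by rw [← Sum.smul_inr, map_smul]; rfl⟩),
        fun p => ⟨Sum.elim p.1 p.2, fun g y => by rcases y with y | y <;> simp⟩,
        fun f => by ext (y | y) <;> rfl, fun p => rfl⟩

theorem orbitProdClass_zero : orbitProdClass (0 : GSetClass G) = 1 := by
  rw [GSetClass.zero_def, orbitProdClass_mk]
  ext a
  rw [orbitProd_apply]
  have : IsEmpty (MulAction.orbitRel.Quotient G Empty) :=
    ⟨fun x => (Quotient.out (s := MulAction.orbitRel G Empty) x).elim⟩
  exact finprod_of_isEmpty _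

theorem orbitProd_quotient [Finite G] (K : Subgroup G) (a : Burnside G) :
    orbitProd (G ⧸ K) a = mark K a := by
  refine congrFun (congruent_ext (congruent_orbitProd (G ⧸ K)) (congruent_mark K) ?_) a
  intro X _ _
  rw [orbitProd_cls, mark_cls]
  congr 1
  refine Nat.card_congr
    ⟨fun f => ⟨f ((1 : G) : G ⧸ K), fun k hk => ?_⟩,
      fun x => ⟨Quotient.lift (fun g : G => g • x.1) ?_, ?_⟩, ?_, ?_⟩
  · rw [← map_smul]
    congr 1
    exact QuotientGroup.eq.2 (by simpa using hk)
  · intro g g' h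
    have := x.2 _ (QuotientGroup.leftRel_apply.1 h)
    change g • x.1 = g' • x.1
    rw [mul_smul, inv_smul_eq_iff] at this
    exact this.symm
  · intro g y
    induction y using QuotientGroup.induction_on with | H y =>
    exact mul_smul g y x.1
  · intro f
    ext y
    induction y using QuotientGroup.induction_on with | H y =>
    change y • f ((1 : G) : G ⧸ K) = _
    rw [← map_smul]
    congr 1
    change ((y * 1 : G) : G ⧸ K) = _
    rw [mul_one]
  · intro x
    ext
    exact one_smul G x.1

end Marks


section Burnside

variable {G : Type} [Group G] [Finite G]

/-! ### Decomposition into orbits, and the injectivity of the marks -/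

theorem exists_split (X : Type) [Finite X] [MulAction G X] (x : X) :
    ∃ (Z : Type) (_ : Finite Z) (_ : MulAction G Z),
      GSetClass.mk G X = GSetClass.mk G (G ⧸ MulAction.stabilizer G x) + GSetClass.mk G Z ∧
      Nat.card Z < Nat.card X := by
  let S : SubMulAction G X :=
    { carrier := (MulAction.orbit G x)ᶜ
      smul_mem' := fun g y hy hgy => hy (by
        have := MulAction.mem_orbit_of_mem_orbit g⁻¹ hgy
        rwa [inv_smul_smul] at this) }
  have hS : ∀ y : X, y ∈ S ↔ y ∉ MulAction.orbit G x := fun y => Iff.rfl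
  refine ⟨S, inferInstance, inferInstance, ?_, ?_⟩
  · rw [GSetClass.mk_add]
    refine GSetClass.mk_eq_mk_iff.2 (GIso.symm ⟨Equiv.ofBijective
      (Sum.elim (MulAction.ofQuotientStabilizer G x) Subtype.val) ⟨?_, ?_⟩, ?_⟩)
    · rw [Sum.elim_injective]
      refine ⟨MulAction.injective_ofQuotientStabilizer G x, Subtype.val_injective, ?_⟩
      intro a b h
      exact (hS b.1).1 b.2 (h ▸ MulAction.ofQuotientStabilizer_mem_orbit G x a)
    · intro y
      by_cases hy : y ∈ MulAction.orbit G x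
      · obtain ⟨g, rfl⟩ := hy
        exact ⟨Sum.inl (g : G ⧸ MulAction.stabilizer G x), rfl⟩
      · exact ⟨Sum.inr ⟨y, hy⟩, rfl⟩
    · rintro g (y | y)
      · exact MulAction.ofQuotientStabilizer_smul G x g y
      · rfl
  · exact Finite.card_subtype_lt (p := fun y => y ∈ S) (x := x)
      (fun h => (hS x).1 h (MulAction.mem_orbit_self x))

theorem gset_ind {P : GSetClass G → Prop} (h0 : P 0)
    (hK : ∀ K : Subgroup G, P (GSetClass.mk G (G ⧸ K)))
    (hadd : ∀ a b, P a → P b → P (a + b)) (a : GSetClass G) : P a := by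
  induction a using GSetClass.ind with | h X =>
  obtain ⟨n, hn⟩ : ∃ n, Nat.card X = n := ⟨_, rfl⟩
  induction n using Nat.strong_induction_on generalizing X with | _ n ih =>
  rcases isEmpty_or_nonempty X with hX | ⟨⟨x⟩⟩
  · have : GSetClass.mk G X = 0 :=
      GSetClass.mk_eq_mk (Equiv.equivOfIsEmpty _ _) (fun g x => isEmptyElim x)
    rwa [this]
  · obtain ⟨Z, _, _, h, hlt⟩ := exists_split (G := G) X x
    rw [h]
    exact hadd _ _ (hK _) (ih _ (hn ▸ hlt) Z rfl)

theorem gset_ext {a b : GSetClass G} (h : ∀ K : Subgroup G, fixCard K a = fixCard K b) :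
    a = b := by
  induction a using GSetClass.ind with | h X =>
  induction b using GSetClass.ind with | h Y =>
  obtain ⟨n, hn⟩ : ∃ n, Nat.card X = n := ⟨_, rfl⟩
  induction n using Nat.strong_induction_on generalizing X Y with | _ n ih =>
  have hne : ∀ (Z : Type) [Finite Z] [MulAction G Z] (K : Subgroup G),
      0 < fixCard K (GSetClass.mk G Z) ↔ ∃ z : Z, K ≤ MulAction.stabilizer G z := by
    intro Z _ _ K
    rw [fixCard_mk, Nat.card_pos_iff]
    exact ⟨fun ⟨⟨z⟩, _⟩ => ⟨z.1, fun k hk => z.2 k hk⟩,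
      fun ⟨z, hz⟩ => ⟨⟨⟨z, fun k hk => hz hk⟩⟩, inferInstance⟩⟩
  rcases isEmpty_or_nonempty X with hX | ⟨⟨x0⟩⟩
  · have hY : IsEmpty Y := by
      by_contra hY
      rw [not_isEmpty_iff] at hY
      obtain ⟨y⟩ := hY
      have h1 := (hne Y ⊥).2 ⟨y, bot_le⟩
      rw [← h] at h1
      obtain ⟨x, _⟩ := (hne X ⊥).1 h1
      exact hX.elim x
    exact GSetClass.mk_eq_mk (Equiv.equivOfIsEmpty _ _) (fun g x => isEmptyElim x)
  · obtain ⟨K, hK, hmax⟩ := Set.exists_max_image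
      {K : Subgroup G | 0 < fixCard K (GSetClass.mk G X)} (fun K => Nat.card K)
      (Set.toFinite _) ⟨⊥, (hne X ⊥).2 ⟨x0, bot_le⟩⟩
    obtain ⟨x, hx⟩ := (hne X K).1 hK
    have hK' := hK
    change 0 < fixCard K (GSetClass.mk G X) at hK'
    rw [h] at hK'
    obtain ⟨y, hy⟩ := (hne Y K).1 hK'
    have hx' : K = MulAction.stabilizer G x :=
      Subgroup.eq_of_le_of_card_ge hx (hmax _ ((hne X _).2 ⟨x, le_rfl⟩))
    have hy' : K = MulAction.stabilizer G y :=
      Subgroup.eq_of_le_of_card_ge hy (hmax _ (by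
        change 0 < fixCard _ (GSetClass.mk G X)
        rw [h]
        exact (hne Y _).2 ⟨y, le_rfl⟩))
    obtain ⟨X', _, _, h1, hlt⟩ := exists_split (G := G) X x
    obtain ⟨Y', _, _, h2, _⟩ := exists_split (G := G) Y y
    rw [← hx'] at h1
    rw [← hy'] at h2
    rw [h1, h2, ih _ (hn ▸ hlt) X' Y' (fun L => ?_) rfl]
    have := h L
    rw [h1, h2, map_add, map_add] at this
    omega

/-- Burnside's theorem: elements of the Burnside ring are determined by their marks. -/
theorem burnside_ext {a b : Burnside G} (h : ∀ K : Subgroup G, mark K a = mark K b) :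
    a = b := by
  induction a using Gro.ind with | h x y =>
  induction b using Gro.ind with | h z w =>
  have : x + w = z + y := gset_ext fun K => by
    have h1 := h K
    simp only [map_sub, mark_of] at h1
    rw [map_add, map_add]
    omega
  rw [sub_eq_sub_iff_add_eq_add, ← map_add, ← map_add, this]

theorem burnside_ext' {a b : Burnside G}
    (h : ∀ z : GSetClass G, orbitProdClass z a = orbitProdClass z b) : a = b :=
  burnside_ext fun K => by
    rw [← orbitProd_quotient, ← orbitProd_quotient, ← orbitProdClass_mk, h]

/-! ### Elements of the Burnside ring with prescribed marks -/

theorem fix_quotient {L K : Subgroup G} (hc : Nat.card K ≤ Nat.card L) (x : Fix L (G ⧸ K)) :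
    GIso G (G ⧸ L) (G ⧸ K) ∧ Nat.card K = Nat.card L := by
  have hle : L ≤ MulAction.stabilizer G x.1 := fun l hl => x.2 l hl
  have hb : Function.Bijective (MulAction.ofQuotientStabilizer G x.1) := by
    refine ⟨MulAction.injective_ofQuotientStabilizer G x.1, fun y => ?_⟩
    obtain ⟨g, hg⟩ := MulAction.exists_smul_eq G x.1 y
    exact ⟨(g : G ⧸ MulAction.stabilizer G x.1), hg⟩
  have hcard := Nat.card_eq_of_bijective _ hb
  have h1 := Subgroup.card_eq_card_quotient_mul_card_subgroup K
  have h2 := Subgroup.card_eq_card_quotient_mul_card_subgroup (MulAction.stabilizer G x.1)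
  rw [hcard, h1] at h2
  have h3 : Nat.card K = Nat.card (MulAction.stabilizer G x.1) :=
    Nat.eq_of_mul_eq_mul_left Nat.card_pos h2
  have h4 : L = MulAction.stabilizer G x.1 := Subgroup.eq_of_le_of_card_ge hle (h3 ▸ hc)
  rw [← h4] at h3
  refine ⟨?_, h3⟩
  rw [h4]
  exact ⟨Equiv.ofBijective _ hb, fun g y => MulAction.ofQuotientStabilizer_smul G x.1 g y⟩

open Classical in
theorem sum_fix_quotient (L : Subgroup G) [Fintype (Subgroup G)] :
    ∑ K : Subgroup G with Nat.card (K : Subgroup G) = Nat.card L, Nat.card L * Nat.card (Fix L (G ⧸ K)) =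
      Nat.card G := by
  have h1 : ∀ K : Subgroup G, Nat.card K = Nat.card L →
      Nat.card L * Nat.card (Fix L (G ⧸ K)) =
        Nat.card {g : G // K = L.map (MulAut.conj g⁻¹).toMonoidHom} := by
    intro K hK
    rw [← hK, ← Nat.card_prod]
    refine Nat.card_congr ((QuotientGroup.preimageMkEquivSubgroupProdSet K
      {x : G ⧸ K | ∀ l ∈ L, l • x = x}).symm.trans (Equiv.subtypeEquivRight fun g => ?_))
    have hmem : (∀ l ∈ L, l • (g : G ⧸ K) = g) ↔ L.map (MulAut.conj g⁻¹).toMonoidHom ≤ K := by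
      rw [Subgroup.map_le_iff_le_comap]
      refine forall₂_congr fun l hl => ?_
      rw [Subgroup.mem_comap]
      change ((l * g : G) : G ⧸ K) = g ↔ _
      rw [eq_comm, QuotientGroup.eq]
      simp [mul_assoc]
    change (∀ l ∈ L, l • (g : G ⧸ K) = g) ↔ _
    rw [hmem]
    have hcard : Nat.card (L.map (MulAut.conj g⁻¹).toMonoidHom) = Nat.card L :=
      Subgroup.card_map_of_injective (MulAut.conj g⁻¹).injective
    exact ⟨fun h => (Subgroup.eq_of_le_of_card_ge h (by rw [hcard, hK])).symm, fun h => h.ge⟩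
  rw [Finset.sum_congr rfl fun K hK => h1 K (Finset.mem_filter.1 hK).2]
  have h2 : ∀ K : Subgroup G, Nat.card K ≠ Nat.card L →
      Nat.card {g : G // K = L.map (MulAut.conj g⁻¹).toMonoidHom} = 0 := by
    intro K hK
    rw [Nat.card_eq_zero]
    left
    refine ⟨fun g => hK ?_⟩
    rw [g.2]
    exact Subgroup.card_map_of_injective (MulAut.conj g.1⁻¹).injective
  rw [Finset.sum_filter_of_ne (fun K _ hK => by
    by_contra h
    exact hK (h2 K h)), ← Nat.card_sigma]
  exact Nat.card_congr ⟨fun p => p.2.1, fun g => ⟨_, g, rfl⟩,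
    fun ⟨K, g, h⟩ => by subst h; rfl, fun g => rfl⟩

theorem mark_congr {K L : Subgroup G} (h : GIso G (G ⧸ K) (G ⧸ L)) (a : Burnside G) :
    mark K a = mark L a := by
  rw [← orbitProd_quotient, ← orbitProd_quotient, orbitProd_congr h]

open Classical in
theorem exists_marks_aux (n : ℕ) : ∀ f : Subgroup G → ℤ,
    (∀ K L, GIso G (G ⧸ K) (G ⧸ L) → f K = f L) → (∀ K, (Nat.card G : ℤ) ^ n ∣ f K) →
    (∀ K : Subgroup G, n < Nat.card K → f K = 0) → ∃ c : Burnside G, ∀ K, mark K c = f K := by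
  induction n with
  | zero =>
    intro f _ _ h0
    exact ⟨0, fun K => by rw [map_zero, h0 K Nat.card_pos]⟩
  | succ n ih =>
    intro f hf hd h0
    let _ := Fintype.ofFinite (Subgroup G)
    choose q hq using hd
    have hpos : (Nat.card G : ℤ) ≠ 0 := by exact_mod_cast Nat.card_pos.ne'
    have hq' : ∀ K L, GIso G (G ⧸ K) (G ⧸ L) → q K = q L := fun K L h => by
      have := hf K L h
      rw [hq, hq] at this
      exact mul_left_cancel₀ (pow_ne_zero _ hpos) this
    let c0 : Burnside G := ∑ K : Subgroup G with Nat.card (K : Subgroup G) = n + 1,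
      ((Nat.card G : ℤ) ^ n * q K * (n + 1 : ℕ)) • cls G (G ⧸ K)
    have hc0 : ∀ L, mark L c0 = ∑ K : Subgroup G with Nat.card (K : Subgroup G) = n + 1,
        ((Nat.card G : ℤ) ^ n * q K * (n + 1 : ℕ)) * Nat.card (Fix L (G ⧸ K)) := fun L => by
      simp only [c0, map_sum, map_zsmul, mark_cls, smul_eq_mul]
    suffices h : ∃ c : Burnside G, ∀ K, mark K c = f K - mark K c0 by
      obtain ⟨c, hc⟩ := h
      exact ⟨c + c0, fun K => by rw [map_add, hc]; ring⟩
    refine ih (fun K => f K - mark K c0) ?_ ?_ ?_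
    · intro K L h
      rw [hf K L h, mark_congr h]
    · intro L
      refine dvd_sub ?_ ?_
      · rw [hq]
        exact Dvd.dvd.mul_right (pow_dvd_pow _ (Nat.le_succ n)) _
      · rw [hc0]
        refine Finset.dvd_sum fun K _ => ?_
        rw [mul_assoc, mul_assoc]
        exact Dvd.intro _ rfl
    · intro L hL
      rcases Nat.lt_or_ge (n + 1) (Nat.card L) with h | h
      · rw [h0 L h, hc0, Finset.sum_eq_zero, sub_zero]
        intro K hK
        have hK := (Finset.mem_filter.1 hK).2
        have : IsEmpty (Fix L (G ⧸ K)) := ⟨fun x => by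
          have := (fix_quotient (by omega) x).2
          omega⟩
        simp
      · have hL' : Nat.card L = n + 1 := by omega
        have h1 : mark L c0 = ∑ K : Subgroup G with Nat.card (K : Subgroup G) = Nat.card L,
            ((Nat.card G : ℤ) ^ n * q L) *
              ((Nat.card L * Nat.card (Fix L (G ⧸ K)) : ℕ) : ℤ) := by
          rw [hc0, hL']
          refine Finset.sum_congr rfl fun K hK => ?_
          have hK := (Finset.mem_filter.1 hK).2
          rcases isEmpty_or_nonempty (Fix L (G ⧸ K)) with hE | ⟨⟨x⟩⟩
          · simp
          · rw [hq' L K (fix_quotient (by omega) x).1]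
            push_cast
            ring
        rw [h1, ← Finset.mul_sum, ← Nat.cast_sum, sum_fix_quotient, hq]
        ring

theorem exists_marks (f : Subgroup G → ℤ)
    (hf : ∀ K L, GIso G (G ⧸ K) (G ⧸ L) → f K = f L)
    (hd : ∀ K, ((Nat.card G ^ Nat.card G : ℕ) : ℤ) ∣ f K) :
    ∃ c : Burnside G, ∀ K, mark K c = f K :=
  exists_marks_aux (Nat.card G) f hf (fun K => by simpa using hd K) fun K hK =>
    absurd hK (not_lt.2 (Nat.card_le_card_of_injective _ K.subtype_injective))

end Burnside

/-! ### Tensor induction -/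

section TensorInduction

variable {K H G : Type} [Group K] [Group H] [Group G]

section HomSet

variable (H G) (U X : Type) [MulAction (H × Gᵐᵒᵖ) U] [MulAction G X]

/-- The set `Hom_G(Uᵒᵖ, X)` of `G`-maps `Uᵒᵖ → X`, i.e. of maps `f : U → X` such that
`f (u g) = g⁻¹ f(u)`, for an `(H, G)`-biset `U` and a `G`-set `X`. -/
@[ext]
structure HomSet : Type where
  toFun : U → X
  map_right : ∀ (g : G) (u : U), toFun (((1, op g) : H × Gᵐᵒᵖ) • u) = g⁻¹ • toFun u

instance [Finite U] [Finite X] : Finite (HomSet H G U X) :=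
  Finite.of_injective HomSet.toFun fun _ _ h => HomSet.ext h

/-- `H` acts on `Hom_G(Uᵒᵖ, X)` by `(h f)(u) = f (h⁻¹ u)`. -/
instance : MulAction H (HomSet H G U X) where
  smul h f := ⟨fun u => f.toFun (((h⁻¹, 1) : H × Gᵐᵒᵖ) • u), fun g u => by
    rw [left_right_comm, f.map_right]⟩
  one_smul f := HomSet.ext (funext fun u => by
    change f.toFun ((((1 : H)⁻¹, 1) : H × Gᵐᵒᵖ) • u) = f.toFun u
    simp [← Prod.one_eq_mk])
  mul_smul h h' f := HomSet.ext (funext fun u => by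
    change f.toFun ((((h * h')⁻¹, 1) : H × Gᵐᵒᵖ) • u) =
      f.toFun (((h'⁻¹, 1) : H × Gᵐᵒᵖ) • ((h⁻¹, 1) : H × Gᵐᵒᵖ) • u)
    simp [smul_smul])

theorem homSet_smul (h : H) (f : HomSet H G U X) (u : U) :
    (h • f).toFun u = f.toFun (((h⁻¹, 1) : H × Gᵐᵒᵖ) • u) := rfl

theorem card_hom_homSet (Z : Type) [MulAction H Z] :
    Nat.card (Z →[H] HomSet H G U X) = Nat.card (Tens G H (OpBiset H G U) Z →[G] X) := by
  refine Nat.card_congr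
    ⟨fun φ => ⟨Tens.lift (fun u z => (φ z).toFun u.val) ?_, ?_⟩,
      fun ψ => ⟨fun z => ⟨fun u => ψ (Tens.mk G H ⟨u⟩ z), ?_⟩, ?_⟩, ?_, ?_⟩
  · intro h u z
    rw [map_smul, homSet_smul, opBiset_smul]
    simp
  · intro g x
    induction x using Tens.ind with | h u z =>
    rw [Tens.smul_mk, Tens.lift_mk, Tens.lift_mk, opBiset_smul]
    have := (φ z).map_right g⁻¹ u.val
    simpa using this
  · intro g u
    rw [← map_smul, Tens.smul_mk, opBiset_smul]
    simp
  · intro h z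
    refine HomSet.ext (funext fun u => ?_)
    change ψ (Tens.mk G H ⟨u⟩ (h • z)) = ψ (Tens.mk G H ⟨((h⁻¹, 1) : H × Gᵐᵒᵖ) • u⟩ z)
    rw [← Tens.mk_right_left, opBiset_smul]
    simp
  · intro φ
    rfl
  · intro ψ
    refine MulActionHom.ext fun x => ?_
    induction x using Tens.ind with | h u z => rfl

end HomSet

variable [Finite H]

theorem exists_tensorInd (u : BisetClass H G) (a : Burnside G) :
    ∃ b : Burnside H, ∀ z : GSetClass H,
      orbitProdClass z b = orbitProdClass (actClass (opClass u) z) a := by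
  induction u using GSetClass.ind with | h U =>
  obtain ⟨x, y, hx⟩ := exists_of_congruent (Nat.card H ^ Nat.card H) (pow_pos Nat.card_pos _) a
  induction x using GSetClass.ind with | h X =>
  let f : Subgroup H → ℤ := fun K => orbitProdClass
    (actClass (opClass (GSetClass.mk (H × Gᵐᵒᵖ) U)) (GSetClass.mk H (H ⧸ K))) a
  suffices h : ∃ c : Burnside H, ∀ K, mark K c = f K - mark K (cls H (HomSet H G U X)) by
    obtain ⟨c, hc⟩ := h
    refine ⟨cls H (HomSet H G U X) + c, fun z => ?_⟩
    induction z using gset_ind with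
    | h0 => rw [map_zero, orbitProdClass_zero, orbitProdClass_zero]; rfl
    | hK K =>
      rw [orbitProdClass_mk, orbitProd_quotient, map_add, hc]
      simp only [f]
      ring
    | hadd z z' hz hz' =>
      rw [map_add (actClass _), orbitProdClass_add, orbitProdClass_add, MonoidHom.mul_apply,
        MonoidHom.mul_apply, hz, hz']
  refine exists_marks (fun K => f K - mark K (cls H (HomSet H G U X))) ?_ ?_
  · intro K L h
    simp only [f]
    rw [GSetClass.mk_eq_mk_iff.2 h, mark_congr h]
  · intro K
    have h1 : mark K (cls H (HomSet H G U X)) = orbitProd (Tens G H (OpBiset H G U) (H ⧸ K))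
        (cls G X) := by
      rw [← orbitProd_quotient, orbitProd_cls, orbitProd_cls, card_hom_homSet]
    simp only [f]
    rw [h1, opClass_mk, actClass_mk, orbitProdClass_mk, cls, hx, dvd_sub_comm]
    exact congruent_orbitProd _ _ _ _

/-- Tensor induction `B(G) → B(H)` along (the class of) an `(H, G)`-biset `U`: the multiplicative
map `b = T_U(a)` characterized by `∏_{z ∈ H\Z} |b ^ (H_z)| = ∏_{y ∈ G\(Uᵒᵖ ×_H Z)} |a ^ (G_y)|`
for all finite `H`-sets `Z`. It extends the map `[X] ↦ [Hom_G(Uᵒᵖ, X)]`, see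
`tensorInd_cls`. -/
def tensorInd (u : BisetClass H G) : Burnside G →* Burnside H where
  toFun a := (exists_tensorInd u a).choose
  map_one' := burnside_ext' fun z => by
    rw [(exists_tensorInd u 1).choose_spec, map_one, map_one]
  map_mul' a b := burnside_ext' fun z => by
    rw [(exists_tensorInd u (a * b)).choose_spec, map_mul, map_mul,
      (exists_tensorInd u a).choose_spec, (exists_tensorInd u b).choose_spec]

theorem tensorInd_spec (u : BisetClass H G) (a : Burnside G) (z : GSetClass H) :
    orbitProdClass z (tensorInd u a) = orbitProdClass (actClass (opClass u) z) a :=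
  (exists_tensorInd u a).choose_spec z

/-- On a finite `G`-set `X`, tensor induction is given by `X ↦ Hom_G(Uᵒᵖ, X)`. -/
theorem tensorInd_cls (U X : Type) [Finite U] [Finite X] [MulAction (H × Gᵐᵒᵖ) U]
    [MulAction G X] :
    tensorInd (GSetClass.mk (H × Gᵐᵒᵖ) U) (cls G X) = cls H (HomSet H G U X) :=
  burnside_ext' fun z => by
    induction z using GSetClass.ind with | h Z =>
    rw [tensorInd_spec, opClass_mk, actClass_mk, orbitProdClass_mk, orbitProdClass_mk,
      orbitProd_cls, orbitProd_cls, card_hom_homSet]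

theorem tensorInd_zero (a : Burnside G) : tensorInd (0 : BisetClass H G) a = 1 :=
  burnside_ext' fun z => by
    rw [tensorInd_spec, map_zero, map_zero, AddMonoidHom.zero_apply, orbitProdClass_zero, map_one]
    rfl

theorem tensorInd_add (u u' : BisetClass H G) (a : Burnside G) :
    tensorInd (u + u') a = tensorInd u a * tensorInd u' a :=
  burnside_ext' fun z => by
    rw [tensorInd_spec, map_add, map_add, AddMonoidHom.add_apply, orbitProdClass_add, map_mul,
      tensorInd_spec, tensorInd_spec]
    rfl

theorem tensorInd_id (a : Burnside H) : tensorInd (idClass H) a = a :=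
  burnside_ext' fun z => by
    rw [tensorInd_spec, opClass_id, actClass_id]

theorem tensorInd_comp [Finite K] (v : BisetClass K H) (u : BisetClass H G) (a : Burnside G) :
    tensorInd (compClass v u) a = tensorInd v (tensorInd u a) :=
  burnside_ext' fun z => by
    rw [tensorInd_spec, opClass_comp, actClass_comp, tensorInd_spec, tensorInd_spec]

end TensorInduction


/-! ### Units of Burnside rings -/

section Units

variable {G : Type} [Group G]

/-- The group of units `B(G)ˣ` of the Burnside ring, written additively. -/
abbrev UnitGroup (G : Type) [Group G] : Type := Additive (Burnside G)ˣ

theorem unit_mul_self [Finite G] (u : (Burnside G)ˣ) : u * u = 1 := by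
  refine Units.ext (burnside_ext fun K => ?_)
  rw [Units.val_mul, map_mul, Units.val_one, map_one]
  exact Int.isUnit_mul_self (u.isUnit.map (mark K))

/-- `B(G)ˣ` is an elementary abelian `2`-group, i.e. a vector space over `𝔽₂`. -/
instance [Finite G] : Module (ZMod 2) (UnitGroup G) :=
  AddCommGroup.zmodModule fun u => by
    rw [two_nsmul]
    exact congrArg Additive.ofMul (unit_mul_self u.toMul)

/-- The isomorphism `s ↦ s₊` from `{±1}` to the additive group of `𝔽₂`. -/
def signPlus : Additive ℤˣ →+ ZMod 2 where
  toFun s := if s.toMul = 1 then 0 else 1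
  map_zero' := by simp
  map_add' s t := by
    rcases Int.units_eq_one_or s.toMul with hs | hs <;>
      rcases Int.units_eq_one_or t.toMul with ht | ht <;>
      simp only [toMul_add, hs, ht] <;> decide

end Units

/-! ### Linearization -/

section Lin

variable (k : Type) [CommRing k] (M : Type) [AddCommMonoid M]

/-- The `k`-linearization `k ⊗_ℤ A` of the Grothendieck group `A` of `M`. -/
def Lin : Type := k ⊗[ℤ] Gro M

instance : AddCommGroup (Lin k M) := inferInstanceAs (AddCommGroup (k ⊗[ℤ] Gro M))

instance : Module k (Lin k M) := inferInstanceAs (Module k (k ⊗[ℤ] Gro M))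

variable {M}

/-- The canonical map from `M` to its linearization. -/
def gen : M →+ Lin k M where
  toFun x := (1 : k) ⊗ₜ[ℤ] Gro.of x
  map_zero' := by rw [map_zero, TensorProduct.tmul_zero]; rfl
  map_add' x y := by rw [map_add, TensorProduct.tmul_add]; rfl

variable {k} {E : Type} [AddCommGroup E] [Module k E]

theorem Lin.hom_ext {f g : Lin k M →ₗ[k] E} (h : ∀ x, f (gen k x) = g (gen k x)) : f = g := by
  refine TensorProduct.AlgebraTensorModule.curry_injective ?_
  ext a
  change f ((1 : k) ⊗ₜ[ℤ] a) = g ((1 : k) ⊗ₜ[ℤ] a)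
  induction a using Gro.ind with | h x y =>
  rw [TensorProduct.tmul_sub]
  exact (map_sub f _ _).trans (((congrArg₂ (· - ·) (h x) (h y))).trans (map_sub g _ _).symm)

/-- Additive maps on `M` extend linearly. -/
def extend (f : M →+ E) : Lin k M →ₗ[k] E :=
  LinearMap.liftBaseChange k (Gro.lift f).toIntLinearMap

@[simp]
theorem extend_gen (f : M →+ E) (x : M) : extend f (gen k x) = f x := by
  change LinearMap.liftBaseChange k (Gro.lift f).toIntLinearMap ((1 : k) ⊗ₜ[ℤ] Gro.of x) = f x
  rw [LinearMap.liftBaseChange_tmul, one_smul]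
  exact Gro.lift_of f x

end Lin

/-! ### The biset category and biset functors -/

section Category

variable (k : Type) [CommRing k]

variable {K H G F : Type} [Group K] [Group H] [Group G] [Group F]

/-- The `k`-bilinear extension `kB(K, H) × kB(H, G) → kB(K, G)` of the composition of bisets. -/
def compLin : Lin k (BisetClass K H) →ₗ[k] Lin k (BisetClass H G) →ₗ[k] Lin k (BisetClass K G) :=
  extend
    { toFun := fun v => extend ((gen k).comp (compClass v))
      map_zero' := Lin.hom_ext fun u => by simp
      map_add' := fun v v' => Lin.hom_ext fun u => by simp }

variable {k} in
@[simp]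
theorem compLin_gen (v : BisetClass K H) (u : BisetClass H G) :
    compLin k (gen k v) (gen k u) = gen k (compClass v u) := by
  simp [compLin]

/-- The linear extension `kB(H, G) → kB(G, H)` of the passage to opposite bisets. -/
def opLin : Lin k (BisetClass H G) →ₗ[k] Lin k (BisetClass G H) :=
  extend ((gen k).comp opClass)

variable {k} in
@[simp]
theorem opLin_gen (u : BisetClass H G) : opLin k (gen k u) = gen k (opClass u) := by
  simp [opLin]

theorem compLin_id_left [Finite H] (a : Lin k (BisetClass H G)) :
    compLin k (gen k (idClass H)) a = a := by
  have : compLin k (gen k (idClass H)) = (LinearMap.id : Lin k (BisetClass H G) →ₗ[k] _) :=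
    Lin.hom_ext fun u => by simp [compClass_id_left]
  rw [this]
  rfl

theorem compLin_id_right [Finite G] (a : Lin k (BisetClass H G)) :
    compLin k a (gen k (idClass G)) = a := by
  have : (compLin k).flip (gen k (idClass G)) = (LinearMap.id : Lin k (BisetClass H G) →ₗ[k] _) :=
    Lin.hom_ext fun u => by simp [compClass_id_right]
  exact LinearMap.congr_fun this a

theorem compLin_assoc (c : Lin k (BisetClass F K)) (b : Lin k (BisetClass K H))
    (a : Lin k (BisetClass H G)) :
    compLin k (compLin k c b) a = compLin k c (compLin k b a) := by
  have h1 : ∀ w v, compLin k (compLin k (gen k w : Lin k (BisetClass F K)) (gen k v)) =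
      (compLin k (gen k w)).comp (compLin k (gen k v : Lin k (BisetClass K H)) :
        Lin k (BisetClass H G) →ₗ[k] _) :=
    fun w v => Lin.hom_ext fun u => by simp [compClass_assoc]
  have h2 : ∀ w, (((compLin k).comp (compLin k (gen k w : Lin k (BisetClass F K)))).flip a) =
      (compLin k (gen k w)).comp ((compLin k : Lin k (BisetClass K H) →ₗ[k] _).flip a) :=
    fun w => Lin.hom_ext fun v => LinearMap.congr_fun (h1 w v) a
  have h3 : ((compLin k : Lin k (BisetClass F H) →ₗ[k] Lin k (BisetClass H G) →ₗ[k] _).flip a).comp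
      ((compLin k : Lin k (BisetClass F K) →ₗ[k] _).flip b) =
      (compLin k : Lin k (BisetClass F K) →ₗ[k] _).flip (compLin k b a) :=
    Lin.hom_ext fun w => LinearMap.congr_fun (h2 w) b
  exact LinearMap.congr_fun h3 c

theorem opLin_comp (b : Lin k (BisetClass K H)) (a : Lin k (BisetClass H G)) :
    opLin k (compLin k b a) = compLin k (opLin k a) (opLin k b) := by
  have h1 : ∀ v, (opLin k).comp (compLin k (gen k v : Lin k (BisetClass K H))) =
      ((compLin k).flip (opLin k (gen k v))).comp
        (opLin k : Lin k (BisetClass H G) →ₗ[k] _) :=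
    fun v => Lin.hom_ext fun u => by simp [opClass_comp]
  have h2 : (opLin k).comp ((compLin k).flip a) =
      (compLin k (opLin k a)).comp (opLin k : Lin k (BisetClass K H) →ₗ[k] _) :=
    Lin.hom_ext fun v => LinearMap.congr_fun (h1 v) a
  exact LinearMap.congr_fun h2 b

theorem opLin_id [Finite G] : opLin k (gen k (idClass G)) = gen k (idClass G) := by
  simp [opClass_id]

/-- The objects of the biset category `k𝒞`: all finite groups. -/
structure BisetCat (k : Type) [CommRing k] : Type 1 where
  carrier : Type
  [group : Group carrier]
  [finite : Finite carrier]

attribute [instance] BisetCat.group BisetCat.finite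

/-- The biset category `k𝒞`: morphisms from `G` to `H` are the elements of
`kB(H, G) = k ⊗ B(H, G)`. -/
instance : Category (BisetCat k) where
  Hom G H := Lin k (BisetClass H.carrier G.carrier)
  id G := gen k (idClass G.carrier)
  comp f g := compLin k g f
  id_comp f := compLin_id_right k f
  comp_id f := compLin_id_left k f
  assoc f g h := (compLin_assoc k h g f).symm

instance : Preadditive (BisetCat k) where
  homGroup G H := inferInstanceAs (AddCommGroup (Lin k (BisetClass H.carrier G.carrier)))
  add_comp _ _ _ f f' g := (compLin k g).map_add f f'
  comp_add _ _ _ f g g' := LinearMap.congr_fun ((compLin k).map_add g g') f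

instance : Linear k (BisetCat k) where
  homModule G H := inferInstanceAs (Module k (Lin k (BisetClass H.carrier G.carrier)))
  smul_comp _ _ _ r f g := (compLin k g).map_smul r f
  comp_smul _ _ _ f r g := LinearMap.congr_fun ((compLin k).map_smul r g) f

/-- The category `ℱ_k` of biset functors over `k`: the `k`-linear functors from `k𝒞` to
`k`-modules, with natural transformations as morphisms. -/
abbrev BisetFunctor : Type 1 :=
  ObjectProperty.FullSubcategory
    (fun F : BisetCat k ⥤ ModuleCat.{0} k => F.Additive ∧ F.Linear k)

variable {k}

/-- The value `F(G)`. -/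
abbrev BisetFunctor.val (F : BisetFunctor k) (G : BisetCat k) : ModuleCat.{0} k := F.obj.obj G

/-- The map `F(α) : F(G) → F(H)`, for `α` in `kB(H, G)`. -/
abbrev BisetFunctor.act (F : BisetFunctor k) {G H : BisetCat k} (α : G ⟶ H) :
    F.val G →ₗ[k] F.val H := (F.obj.map α).hom

/-- The biset functor over `k` with given values on groups and on classes of bisets. -/
def mkFunctor (V : BisetCat k → Type) [∀ G, AddCommGroup (V G)] [∀ G, Module k (V G)]
    (ρ : ∀ G H : BisetCat k, BisetClass H.carrier G.carrier →+ (V G →ₗ[k] V H))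
    (hid : ∀ G, ρ G G (idClass G.carrier) = LinearMap.id)
    (hcomp : ∀ (G H K : BisetCat k) (v : BisetClass K.carrier H.carrier)
      (u : BisetClass H.carrier G.carrier), ρ G K (compClass v u) = (ρ H K v).comp (ρ G H u)) :
    BisetFunctor k where
  obj :=
    { obj := fun G => ModuleCat.of k (V G)
      map := fun {G H} α => ModuleCat.ofHom
        (extend (ρ G H) α)
      map_id := fun G => by
        ext1
        change extend (ρ G G) (gen k (idClass G.carrier)) = LinearMap.id
        rw [extend_gen, hid]
      map_comp := fun {G H K} α β => by
        ext1
        change extend (ρ G K) (compLin k β α) = (extend (ρ H K) β).comp (extend (ρ G H) α)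
        have h1 : ∀ v, (extend (ρ G K)).comp (compLin k (gen k v)) =
            (LinearMap.llcomp k _ _ _ (extend (ρ H K) (gen k v))).comp (extend (ρ G H)) :=
          fun v => Lin.hom_ext fun u => by simp [hcomp]; rfl
        have h2 : (extend (ρ G K)).comp ((compLin k).flip α) =
            ((LinearMap.llcomp k _ _ _).flip (extend (ρ G H) α)).comp (extend (ρ H K)) :=
          Lin.hom_ext fun v => LinearMap.congr_fun (h1 v) α
        exact LinearMap.congr_fun h2 β }
  property := ⟨⟨fun {G H α β} => ModuleCat.hom_ext (map_add (extend (ρ G H)) α β)⟩,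
    ⟨fun {G H} α r => ModuleCat.hom_ext (map_smul (extend (ρ G H)) r α)⟩⟩

theorem mkFunctor_act_gen (V : BisetCat k → Type) [∀ G, AddCommGroup (V G)] [∀ G, Module k (V G)]
    (ρ : ∀ G H : BisetCat k, BisetClass H.carrier G.carrier →+ (V G →ₗ[k] V H))
    (hid : ∀ G, ρ G G (idClass G.carrier) = LinearMap.id)
    (hcomp : ∀ (G H K : BisetCat k) (v : BisetClass K.carrier H.carrier)
      (u : BisetClass H.carrier G.carrier), ρ G K (compClass v u) = (ρ H K v).comp (ρ G H u))
    (G H : BisetCat k) (u : BisetClass H.carrier G.carrier) :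
    (mkFunctor V ρ hid hcomp).act (G := G) (H := H) (gen k u) = ρ G H u :=
  extend_gen (k := k) (ρ G H) u

/-- A morphism of biset functors from a family of linear maps compatible with all bisets. -/
def mkHom (F F' : BisetFunctor k) (η : ∀ G : BisetCat k, F.val G →ₗ[k] F'.val G)
    (h : ∀ (G H : BisetCat k) (u : BisetClass H.carrier G.carrier),
      (η H).comp (F.act (G := G) (H := H) (gen k u)) =
        (F'.act (G := G) (H := H) (gen k u)).comp (η G)) : F ⟶ F' :=
  ObjectProperty.homMk
    { app := fun G => ModuleCat.ofHom (η G)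
      naturality := fun G H α => by
        let lin : ∀ F : BisetFunctor k,
            Lin k (BisetClass H.carrier G.carrier) →ₗ[k] (F.val G →ₗ[k] F.val H) := fun F =>
          { toFun := fun α => F.act (G := G) (H := H) α
            map_add' := fun α β => congrArg ModuleCat.Hom.hom
              (F.property.1.map_add (X := G) (Y := H) (f := α) (g := β))
            map_smul' := fun r α => congrArg ModuleCat.Hom.hom
              (F.property.2.map_smul (X := G) (Y := H) α r) }
        have h1 : (LinearMap.llcomp k _ _ _ (η H)).comp (lin F) =
            ((LinearMap.llcomp k _ _ _).flip (η G)).comp (lin F') :=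
          Lin.hom_ext fun u => h G H u
        exact ModuleCat.hom_ext (LinearMap.congr_fun h1 α) }

/-- The action `[X] ↦ [U ×_G X]` of (the class of) an `(H, G)`-biset `U`, from `kB(G)` to
`kB(H)`. -/
def burnsideAct (k : Type) [CommRing k] :
    BisetClass H G →+ (Lin k (GSetClass G) →ₗ[k] Lin k (GSetClass H)) where
  toFun u := extend ((gen k).comp (actClass u))
  map_zero' := Lin.hom_ext fun x => by simp
  map_add' u u' := Lin.hom_ext fun x => by simp

theorem burnsideAct_gen (u : BisetClass H G) (x : GSetClass G) :
    burnsideAct k u (gen k x) = gen k (actClass u x) := by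
  simp [burnsideAct]

/-- The linearized Burnside functor `kB`: `kB(G) = k ⊗ B(G)`, and `[U][X] = [U ×_G X]` for an
`(H, G)`-biset `U` and a `G`-set `X`. -/
def burnsideFunctor (k : Type) [CommRing k] : BisetFunctor k :=
  mkFunctor (fun G => Lin k (GSetClass G.carrier)) (fun _ _ => burnsideAct k)
    (fun G => Lin.hom_ext fun x => by simp [burnsideAct_gen, actClass_id])
    (fun G H K v u => Lin.hom_ext fun x => by simp [burnsideAct_gen, actClass_comp])

/-- The action of (the class of) an `(H, G)`-biset on units by tensor induction. -/
def unitAct [Finite H] [Finite G] :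
    BisetClass H G →+ (UnitGroup G →ₗ[ZMod 2] UnitGroup H) where
  toFun u := (MonoidHom.toAdditive (Units.map (tensorInd u))).toZModLinearMap 2
  map_zero' := by
    refine LinearMap.ext fun x => Additive.toMul.injective (Units.ext ?_)
    exact tensorInd_zero _
  map_add' u u' := by
    refine LinearMap.ext fun x => Additive.toMul.injective (Units.ext ?_)
    exact tensorInd_add u u' _

/-- The biset functor `Bˣ` over `𝔽₂`: `Bˣ(G)` is the group of units of the Burnside ring `B(G)`,
and bisets act by tensor induction. -/
def unitFunctor : BisetFunctor (ZMod 2) :=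
  mkFunctor (fun G => UnitGroup G.carrier) (fun _ _ => unitAct)
    (fun G => by
      refine LinearMap.ext fun x => Additive.toMul.injective (Units.ext ?_)
      exact tensorInd_id _)
    (fun G H K v u => by
      refine LinearMap.ext fun x => Additive.toMul.injective (Units.ext ?_)
      exact tensorInd_comp v u _)

/-- The `M`-dual `Hom_k(F, M)` of a biset functor `F`: an element `α` of `kB(H, G)` acts by the
transpose of `F(αᵒᵖ)`. -/
def dualFunctor (F : BisetFunctor k) (M : Type) [AddCommGroup M] [Module k M] :
    BisetFunctor k where
  obj :=
    { obj := fun G => ModuleCat.of k (F.val G →ₗ[k] M)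
      map := fun {G H} α => ModuleCat.ofHom
        (LinearMap.lcomp k M (F.act (G := H) (H := G) (opLin k α)))
      map_id := fun G => by
        ext1
        have : F.obj.map (X := G) (Y := G) (opLin k (gen k (idClass G.carrier))) = 𝟙 _ := by
          rw [opLin_id]
          exact F.obj.map_id G
        change LinearMap.lcomp k M
          (F.obj.map (X := G) (Y := G) (opLin k (gen k (idClass G.carrier)))).hom = LinearMap.id
        rw [this]
        rfl
      map_comp := fun {G H K} α β => by
        ext1
        have : F.obj.map (X := K) (Y := G) (opLin k (compLin k β α)) =
            F.obj.map (X := K) (Y := H) (opLin k β) ≫ F.obj.map (X := H) (Y := G) (opLin k α) := by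
          rw [opLin_comp]
          exact F.obj.map_comp (X := K) (Y := H) (Z := G) (opLin k β) (opLin k α)
        change LinearMap.lcomp k M (F.obj.map (X := K) (Y := G) (opLin k (compLin k β α))).hom = _
        rw [this]
        rfl }
  property := by
    obtain ⟨hadd, hlin⟩ := F.property
    refine ⟨⟨fun {G H α β} => ModuleCat.hom_ext ?_⟩, ⟨fun {G H} α r => ModuleCat.hom_ext ?_⟩⟩
    · have : F.obj.map (X := H) (Y := G) (opLin k (α + β)) =
          F.obj.map (X := H) (Y := G) (opLin k α) + F.obj.map (X := H) (Y := G) (opLin k β) := by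
        rw [← hadd.map_add]
        exact congrArg (F.obj.map (X := H) (Y := G)) (map_add (opLin k) α β)
      change LinearMap.lcomp k M (F.obj.map (X := H) (Y := G) (opLin k (α + β))).hom = _
      rw [this]
      refine LinearMap.ext fun φ => LinearMap.ext fun x => ?_
      exact map_add φ _ _
    · have : F.obj.map (X := H) (Y := G) (opLin k (r • α)) =
          r • F.obj.map (X := H) (Y := G) (opLin k α) := by
        rw [← hlin.map_smul]
        exact congrArg (F.obj.map (X := H) (Y := G)) (map_smul (opLin k) r α)
      change LinearMap.lcomp k M (F.obj.map (X := H) (Y := G) (opLin k (r • α))).hom = _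
      rw [this]
      refine LinearMap.ext fun φ => LinearMap.ext fun x => ?_
      exact map_smul φ r _

theorem dualFunctor_act_gen (F : BisetFunctor k) (M : Type) [AddCommGroup M] [Module k M]
    (G H : BisetCat k) (u : BisetClass H.carrier G.carrier) (φ : F.val G →ₗ[k] M) :
    (dualFunctor F M).act (G := G) (H := H) (gen k u) φ =
      φ.comp (F.act (G := H) (H := G) (gen k (opClass u))) := by
  rw [← opLin_gen]
  rfl

end Category


/-! ### The morphism from the Burnside functor to the dual of the functor of units -/

section Jmath

variable {G : Type} [Group G] [Finite G]

/-- The linear form on `Bˣ(G)` attached to (the class of) a finite `G`-set `Y`: the additive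
extension of `G/K ↦ (u ↦ |u ^ K|₊)`. -/
def jClass : GSetClass G →+ (UnitGroup G →ₗ[ZMod 2] ZMod 2) where
  toFun y :=
    (signPlus.comp (MonoidHom.toAdditive (Units.map (orbitProdClass y)))).toZModLinearMap 2
  map_zero' := LinearMap.ext fun u => by
    change signPlus (Additive.ofMul (Units.map (orbitProdClass 0) u.toMul)) = 0
    rw [orbitProdClass_zero, ← map_zero signPlus]
    exact congrArg signPlus (Additive.toMul.injective (Units.ext rfl))
  map_add' y y' := LinearMap.ext fun u => by
    change signPlus (Additive.ofMul (Units.map (orbitProdClass (y + y')) u.toMul)) =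
      signPlus (Additive.ofMul (Units.map (orbitProdClass y) u.toMul)) +
      signPlus (Additive.ofMul (Units.map (orbitProdClass y') u.toMul))
    rw [orbitProdClass_add, ← map_add signPlus]
    exact congrArg signPlus (Additive.toMul.injective (Units.ext rfl))

theorem jClass_apply (y : GSetClass G) (u : UnitGroup G) :
    jClass y u = signPlus (Additive.ofMul (Units.map (orbitProdClass y) u.toMul)) := rfl

/-- On the transitive `G`-set `G/K`, the linear form is `u ↦ |u ^ K|₊`. -/
theorem jClass_quotient (K : Subgroup G) (u : UnitGroup G) :
    jClass (GSetClass.mk G (G ⧸ K)) u =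
      signPlus (Additive.ofMul (Units.map (mark K : Burnside G →* ℤ) u.toMul)) := by
  rw [jClass_apply]
  refine congrArg signPlus (Additive.toMul.injective (Units.ext ?_))
  change orbitProdClass (GSetClass.mk G (G ⧸ K)) (u.toMul : Burnside G) = mark K u.toMul
  rw [orbitProdClass_mk, orbitProd_quotient]

theorem jClass_act {H : Type} [Group H] [Finite H] (a : BisetClass H G) (x : GSetClass G)
    (u : UnitGroup H) :
    jClass (actClass a x) u =
      jClass x (Additive.ofMul (Units.map (tensorInd (opClass a)) u.toMul)) := by
  rw [jClass_apply, jClass_apply]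
  refine congrArg signPlus (Additive.toMul.injective (Units.ext ?_))
  change orbitProdClass (actClass a x) (u.toMul : Burnside H) =
    orbitProdClass x (tensorInd (opClass a) u.toMul)
  rw [tensorInd_spec, opClass_opClass]

/-- The linear map `𝔽₂B(G) → Hom(Bˣ(G), 𝔽₂)` with `G/K ↦ (u ↦ |u ^ K|₊)`. -/
def jLin (G : Type) [Group G] [Finite G] :
    Lin (ZMod 2) (GSetClass G) →ₗ[ZMod 2] (UnitGroup G →ₗ[ZMod 2] ZMod 2) := extend jClass

theorem jLin_gen (x : GSetClass G) : jLin G (gen (ZMod 2) x) = jClass x :=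
  extend_gen jClass x

end Jmath

/-- The dual functor of `Bˣ`, with values `Hom_{𝔽₂}(Bˣ(G), 𝔽₂)`. -/
def dualUnitFunctor : BisetFunctor (ZMod 2) := dualFunctor unitFunctor (ZMod 2)

/-- The morphism of biset functors `𝔽₂B → Hom(Bˣ, 𝔽₂)`, with `G/K ↦ (u ↦ |u ^ K|₊)`. -/
def jmath : burnsideFunctor (ZMod 2) ⟶ dualUnitFunctor :=
  mkHom (burnsideFunctor (ZMod 2)) dualUnitFunctor
    (fun G => jLin G.carrier)
    (fun G H a => by
      refine Lin.hom_ext fun x => ?_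
      have h1 : (burnsideFunctor (ZMod 2)).act (G := G) (H := H) (gen (ZMod 2) a) =
        burnsideAct (ZMod 2) a := mkFunctor_act_gen _ _ _ _ G H a
      have h2 : unitFunctor.act (G := H) (H := G) (gen (ZMod 2) (opClass a)) =
        unitAct (opClass a) := mkFunctor_act_gen _ _ _ _ H G (opClass a)
      have h3 := dualFunctor_act_gen unitFunctor (ZMod 2) G H a (jClass x)
      rw [h2] at h3
      rw [h1]
      change jLin H.carrier (burnsideAct (ZMod 2) a (gen (ZMod 2) x)) =
        dualUnitFunctor.act (G := G) (H := H) (gen (ZMod 2) a) (jLin G.carrier (gen (ZMod 2) x))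
      rw [burnsideAct_gen, jLin_gen, jLin_gen]
      exact (LinearMap.ext fun u => jClass_act a x u).trans h3.symm)

/-! ### Subfunctors, generation and finiteness conditions -/

section Subfunctor

variable {k : Type} [CommRing k]

/-- A subfunctor of a biset functor. -/
structure Subfunctor (F : BisetFunctor k) where
  obj : ∀ G : BisetCat k, Submodule k (F.val G)
  map_mem : ∀ {G H : BisetCat k} (α : G ⟶ H) {v : F.val G}, v ∈ obj G → F.act α v ∈ obj H

/-- A subfunctor, as a biset functor. -/
def Subfunctor.toFunctor {F : BisetFunctor k} (S : Subfunctor F) : BisetFunctor k where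
  obj :=
    { obj := fun G => ModuleCat.of k (S.obj G)
      map := fun α => ModuleCat.ofHom ((F.act α).restrict fun _ hv => S.map_mem α hv)
      map_id := fun G => ModuleCat.hom_ext (LinearMap.ext fun v => Subtype.ext
        (LinearMap.congr_fun (congrArg ModuleCat.Hom.hom (F.obj.map_id G)) v.1))
      map_comp := fun α β => ModuleCat.hom_ext (LinearMap.ext fun v => Subtype.ext
        (LinearMap.congr_fun (congrArg ModuleCat.Hom.hom (F.obj.map_comp α β)) v.1)) }
  property :=
    ⟨⟨fun {_ _ _ _} => ModuleCat.hom_ext (LinearMap.ext fun v => Subtype.ext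
        (LinearMap.congr_fun (congrArg ModuleCat.Hom.hom F.property.1.map_add) v.1))⟩,
      ⟨fun α r => ModuleCat.hom_ext (LinearMap.ext fun v => Subtype.ext
        (LinearMap.congr_fun (congrArg ModuleCat.Hom.hom (F.property.2.map_smul α r)) v.1))⟩⟩

/-- The component at `G` of a morphism of biset functors. -/
def component {F F' : BisetFunctor k} (η : F ⟶ F') (G : BisetCat k) : F.val G →ₗ[k] F'.val G :=
  (η.hom.app G).hom

theorem component_act {F F' : BisetFunctor k} (η : F ⟶ F') {G H : BisetCat k} (α : G ⟶ H)
    (v : F.val G) : component η H (F.act α v) = F'.act α (component η G v) :=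
  LinearMap.congr_fun (congrArg ModuleCat.Hom.hom (η.hom.naturality α)) v

/-- The kernel of a morphism of biset functors. -/
def kernelSubfunctor {F F' : BisetFunctor k} (η : F ⟶ F') : Subfunctor F where
  obj G := LinearMap.ker (component η G)
  map_mem α v hv := by
    rw [LinearMap.mem_ker] at hv ⊢
    rw [component_act, hv, map_zero]

/-- The elements of a biset functor `F`: the pairs `(R, v)` with `R` a finite group and `v` in
`F(R)`. -/
abbrev Elements (F : BisetFunctor k) : Type 1 := Σ R : BisetCat k, F.val R

/-- The subfunctor generated by a set `𝒢` of elements: the intersection of all subfunctors that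
contain `𝒢`. -/
def generated (F : BisetFunctor k) (𝒢 : Set (Elements F)) : Subfunctor F where
  obj G := ⨅ S : {S : Subfunctor F // ∀ p ∈ 𝒢, p.2 ∈ S.obj p.1}, S.1.obj G
  map_mem α v hv := by
    rw [Submodule.mem_iInf] at hv ⊢
    exact fun S => S.1.map_mem α (hv S)

/-- `𝒢` generates `F`, i.e. `⟨𝒢⟩ = F`. -/
def Generates (F : BisetFunctor k) (𝒢 : Set (Elements F)) : Prop :=
  ∀ G : BisetCat k, (generated F 𝒢).obj G = ⊤

/-- Finitely generated biset functors. -/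
def FinitelyGenerated (F : BisetFunctor k) : Prop :=
  ∃ 𝒢 : Set (Elements F), 𝒢.Finite ∧ Generates F 𝒢

/-- Finitely presented biset functors: those `F` for which there is an exact sequence
`Q → P → F → 0` where `P` and `Q` are finitely generated and projective. -/
def FinitelyPresented (F : BisetFunctor k) : Prop :=
  ∃ (Q P : BisetFunctor k) (f : Q ⟶ P) (g : P ⟶ F),
    FinitelyGenerated Q ∧ Projective Q ∧ FinitelyGenerated P ∧ Projective P ∧
    (∀ G : BisetCat k, Function.Exact (component f G) (component g G)) ∧
    ∀ G : BisetCat k, Function.Surjective (component g G)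

/-- The trivial group, as an object of the biset category. -/
def trivialGroup (k : Type) [CommRing k] : BisetCat k := ⟨Unit⟩

end Subfunctor

/-- The kernel `L` of `𝔽₂B → Hom(Bˣ, 𝔽₂)`, as a biset functor over `𝔽₂`. -/
def kernelFunctor : BisetFunctor (ZMod 2) := (kernelSubfunctor jmath).toFunctor

end BurnsideUnits

end

/-!
A `G`-set is a `(G, 1)`-biset applied to the point, so the point generates `kB`; and `jmath` is
onto by duality, because a unit of `B(G)` is determined by its marks. Hence the image of the point
generates the dual of `Bˣ`.

If `F(1) = 0`, every biset between groups of coprime orders acts on `F` by zero, since it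
decomposes into bisets that factor through the trivial group. A finitely generated such `F`
therefore vanishes on all groups of order prime to some `N ≠ 0`. But `L(1) = 0`, whereas
`G/1 - G/G` is a non-zero element of `L(G)` for each non-trivial `p`-group `G` with `p` odd: the
marks of a unit at `1` and at `G` are signs that agree modulo `p`.

Finally, lifting a projective presentation of `F` along an epimorphism `P' ⟶ F` shows that the
kernel of this epimorphism is finitely generated when `F` is finitely presented and `P'` is
finitely generated.
-/

noncomputable section

namespace BurnsideUnits

section Linearization

variable {k M : Type} [CommRing k] [AddCommMonoid M]

theorem Lin.eq_top_of_gen_mem {p : Submodule k (Lin k M)} (h : ∀ x, gen k x ∈ p) : p = ⊤ := by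
  rw [← p.ker_mkQ, LinearMap.ker_eq_top]
  exact Lin.hom_ext fun x => (Submodule.Quotient.mk_eq_zero p).2 (h x)

end Linearization

section Evaluation

variable {k : Type} [CommRing k]

namespace BisetFunctor

theorem act_id (F : BisetFunctor k) {G : BisetCat k} (v : F.val G) : F.act (𝟙 G) v = v :=
  LinearMap.congr_fun (congrArg ModuleCat.Hom.hom (F.obj.map_id G)) v

theorem act_comp (F : BisetFunctor k) {G H K : BisetCat k} (α : G ⟶ H) (β : H ⟶ K)
    (v : F.val G) : F.act (α ≫ β) v = F.act β (F.act α v) :=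
  LinearMap.congr_fun (congrArg ModuleCat.Hom.hom (F.obj.map_comp α β)) v

/-- The evaluation `α ↦ F(α)(v)` at `v ∈ F(G)`: the component at `H` of the morphism of biset
functors `Hom(G, -) ⟶ F` that corresponds to `v` under the Yoneda lemma. -/
def evalAt (F : BisetFunctor k) {G : BisetCat k} (v : F.val G) (H : BisetCat k) :
    (G ⟶ H) →ₗ[k] F.val H where
  toFun α := F.act α v
  map_add' _ _ := LinearMap.congr_fun (congrArg ModuleCat.Hom.hom F.property.1.map_add) v
  map_smul' r α := LinearMap.congr_fun (congrArg ModuleCat.Hom.hom (F.property.2.map_smul α r)) v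

end BisetFunctor

theorem epi_of_surjective {F F' : BisetFunctor k} {η : F ⟶ F'}
    (hη : ∀ G, Function.Surjective (component η G)) : Epi η where
  left_cancellation θ θ' h := by
    refine ObjectProperty.hom_ext _ (NatTrans.ext (funext fun G => ModuleCat.hom_ext ?_))
    rw [← LinearMap.cancel_right (hη G)]
    exact congrArg (component · G) h

end Evaluation

section Generation

variable {k : Type} [CommRing k] {F F' : BisetFunctor k}

namespace Subfunctor

/-- The inclusion of a subfunctor. -/
def ι (S : Subfunctor F) : S.toFunctor ⟶ F :=
  ObjectProperty.homMk { app := fun G => ModuleCat.ofHom (S.obj G).subtype }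

/-- The image of a subfunctor under a morphism. -/
def map (η : F ⟶ F') (S : Subfunctor F) : Subfunctor F' where
  obj G := (S.obj G).map (component η G)
  map_mem α := by
    rintro _ ⟨v, hv, rfl⟩
    exact ⟨F.act α v, S.map_mem α hv, component_act η α v⟩

/-- The inverse image of a subfunctor under a morphism. -/
def comap (η : F ⟶ F') (S : Subfunctor F') : Subfunctor F where
  obj G := (S.obj G).comap (component η G)
  map_mem α v hv := by
    rw [Submodule.mem_comap, component_act]
    exact S.map_mem α hv

/-- The sum of two subfunctors. -/
instance : Max (Subfunctor F) where
  max S T :=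
    { obj := fun G => S.obj G ⊔ T.obj G
      map_mem := fun {G H} α v hv => by
        have hS : S.obj G ≤ (S.obj H ⊔ T.obj H).comap (F.act α) := fun _ hw =>
          Submodule.mem_sup_left (S.map_mem α hw)
        have hT : T.obj G ≤ (S.obj H ⊔ T.obj H).comap (F.act α) := fun _ hw =>
          Submodule.mem_sup_right (T.map_mem α hw)
        exact sup_le hS hT hv }

instance : Top (Subfunctor F) where
  top := { obj := fun _ => ⊤, map_mem := fun _ _ _ => Submodule.mem_top }

end Subfunctor

theorem generated_obj_le {𝒢 : Set (Elements F)} {S : Subfunctor F}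
    (hS : ∀ p ∈ 𝒢, p.2 ∈ S.obj p.1) (G : BisetCat k) : (generated F 𝒢).obj G ≤ S.obj G :=
  iInf_le (fun S : {S : Subfunctor F // ∀ p ∈ 𝒢, p.2 ∈ S.obj p.1} => S.1.obj G) ⟨S, hS⟩

theorem mem_generated {𝒢 : Set (Elements F)} {G : BisetCat k} {v : F.val G} (h : ⟨G, v⟩ ∈ 𝒢) :
    v ∈ (generated F 𝒢).obj G :=
  (Submodule.mem_iInf _).2 fun S => S.2 ⟨G, v⟩ h

theorem Generates.obj_eq_top {𝒢 : Set (Elements F)} (h : Generates F 𝒢) {S : Subfunctor F}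
    (hS : ∀ p ∈ 𝒢, p.2 ∈ S.obj p.1) (G : BisetCat k) : S.obj G = ⊤ :=
  top_le_iff.1 ((h G).ge.trans (generated_obj_le hS G))

/-- The image of an element of `F` under a morphism of biset functors `F ⟶ F'`. -/
def mapElement (η : F ⟶ F') (p : Elements F) : Elements F' := ⟨p.1, component η p.1 p.2⟩

theorem Generates.component_mem_generated {𝒢 : Set (Elements F)} (h : Generates F 𝒢) {η : F ⟶ F'}
    {𝒢' : Set (Elements F')} (h𝒢 : ∀ p ∈ 𝒢, mapElement η p ∈ 𝒢') {G : BisetCat k} (v : F.val G) :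
    component η G v ∈ (generated F' 𝒢').obj G :=
  (Submodule.eq_top_iff'.1 (h.obj_eq_top (S := (generated F' 𝒢').comap η)
    (fun p hp => mem_generated (h𝒢 p hp)) G)) v

theorem Generates.image {𝒢 : Set (Elements F)} (h : Generates F 𝒢) {η : F ⟶ F'}
    (hη : ∀ G, Function.Surjective (component η G)) : Generates F' (mapElement η '' 𝒢) := by
  refine fun G => Submodule.eq_top_iff'.2 fun w => ?_
  obtain ⟨v, rfl⟩ := hη G w
  exact h.component_mem_generated (fun p hp => Set.mem_image_of_mem _ hp) v

theorem finitelyGenerated_toFunctor {S : Subfunctor F} {𝒢 : Set (Elements F)} (hfin : 𝒢.Finite)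
    (h𝒢 : ∀ p ∈ 𝒢, p.2 ∈ S.obj p.1) (hS : ∀ G, S.obj G ≤ (generated F 𝒢).obj G) :
    FinitelyGenerated S.toFunctor := by
  have hinj : Function.Injective (mapElement S.ι) := by
    rintro ⟨G, v⟩ ⟨H, w⟩ h
    obtain ⟨rfl, h⟩ := Sigma.mk.inj h
    exact congrArg (Sigma.mk G) (Subtype.ext (eq_of_heq h))
  refine ⟨mapElement S.ι ⁻¹' 𝒢, hfin.preimage hinj.injOn, fun G => ?_⟩
  set T := generated S.toFunctor (mapElement S.ι ⁻¹' 𝒢)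
  have hT : ∀ p ∈ 𝒢, p.2 ∈ (T.map S.ι).obj p.1 := fun p hp =>
    ⟨(⟨p.2, h𝒢 p hp⟩ : S.obj p.1), mem_generated (show mapElement S.ι _ ∈ 𝒢 from hp), rfl⟩
  refine Submodule.eq_top_iff'.2 fun v => ?_
  obtain ⟨w, hw, hwv⟩ := generated_obj_le hT G (hS G v.2)
  rwa [← Subtype.ext hwv]

end Generation

section Presentation

variable {k : Type} [CommRing k] {Q P P' F : BisetFunctor k}

theorem finitelyGenerated_kernel_of_exact {f : Q ⟶ P} {g : P ⟶ F} {ψ : P ⟶ P'} {η : P' ⟶ F}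
    (hexact : ∀ G, Function.Exact (component f G) (component g G))
    (hg : ∀ G, Function.Surjective (component g G)) (hψ : ψ ≫ η = g)
    (hQ : FinitelyGenerated Q) (hP' : FinitelyGenerated P') :
    FinitelyGenerated (kernelSubfunctor η).toFunctor := by
  obtain ⟨𝒬, h𝒬fin, h𝒬⟩ := hQ
  obtain ⟨𝒢, h𝒢fin, h𝒢⟩ := hP'
  have hηψ (G) (w : P.val G) : component η G (component ψ G w) = component g G w :=
    LinearMap.congr_fun (congrArg (component · G) hψ) w
  -- The elements `x - ψ w`, with `x` a generator of `P'` and `g w = η x`, lie in the kernel.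
  choose w hw using fun p : Elements P' => hg p.1 (component η p.1 p.2)
  let δ : Elements P' → Elements P' := fun p => ⟨p.1, p.2 - component ψ p.1 (w p)⟩
  let 𝒦 : Set (Elements P') := δ '' 𝒢 ∪ mapElement (f ≫ ψ) '' 𝒬
  have h𝒦 : ∀ p ∈ 𝒦, p.2 ∈ (kernelSubfunctor η).obj p.1 := by
    rintro _ (⟨p, -, rfl⟩ | ⟨q, -, rfl⟩)
    · exact (map_sub _ _ _).trans (sub_eq_zero.2 ((hw p).symm.trans (hηψ p.1 (w p)).symm))
    · exact (hηψ q.1 _).trans ((hexact q.1).apply_apply_eq_zero q.2)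
  have hsup (G) : (generated P' 𝒦 ⊔ (⊤ : Subfunctor P).map ψ).obj G = ⊤ := by
    refine h𝒢.obj_eq_top (fun p hp => ?_) G
    rw [← sub_add_cancel p.2 (component ψ p.1 (w p))]
    exact Submodule.add_mem_sup (mem_generated (.inl ⟨p, hp, rfl⟩))
      (Submodule.mem_map_of_mem Submodule.mem_top)
  refine finitelyGenerated_toFunctor ((h𝒢fin.image δ).union (h𝒬fin.image _)) h𝒦 fun G x hx => ?_
  obtain ⟨s, hs, _, ⟨y, -, rfl⟩, rfl⟩ := Submodule.mem_sup.1 (Submodule.eq_top_iff'.1 (hsup G) x)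
  have hy : component g G y = 0 := by
    have hs' : component η G s = 0 := generated_obj_le h𝒦 G hs
    have hx' : component η G (s + component ψ G y) = 0 := hx
    rwa [map_add, hs', zero_add, hηψ] at hx'
  obtain ⟨q, rfl⟩ := (hexact G y).1 hy
  exact add_mem hs (h𝒬.component_mem_generated (η := f ≫ ψ)
    (fun q hq => Set.mem_union_right _ (Set.mem_image_of_mem _ hq)) q)

theorem FinitelyPresented.finitelyGenerated_kernel (hF : FinitelyPresented F) {η : P' ⟶ F}
    (hη : ∀ G, Function.Surjective (component η G)) (hP' : FinitelyGenerated P') :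
    FinitelyGenerated (kernelSubfunctor η).toFunctor := by
  obtain ⟨Q, P, f, g, hQ, -, -, hP, hexact, hg⟩ := hF
  have : Epi η := epi_of_surjective hη
  exact finitelyGenerated_kernel_of_exact hexact hg (Projective.factorThru_comp g η) hQ hP'

end Presentation

section Coprime

theorem mk_quotient_stabilizer {G X : Type} [Group G] [Finite G] [MulAction G X] [Finite X]
    [MulAction.IsPretransitive G X] (x : X) :
    GSetClass.mk G (G ⧸ MulAction.stabilizer G x) = GSetClass.mk G X := by
  have hsurj : Function.Surjective (MulAction.ofQuotientStabilizer G x) := fun y => by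
    obtain ⟨g, rfl⟩ := MulAction.exists_smul_eq G x y
    exact ⟨(g : G ⧸ MulAction.stabilizer G x), rfl⟩
  exact GSetClass.mk_eq_mk
    (Equiv.ofBijective _ ⟨MulAction.injective_ofQuotientStabilizer G x, hsurj⟩)
    (MulAction.ofQuotientStabilizer_smul G x)

variable {G R : Type} [Group G] [Group R]

theorem inl_mem_of_coprime (h : (Nat.card G).Coprime (Nat.card R)) {M : Subgroup (G × R)}
    {m : G × R} (hm : m ∈ M) : (m.1, 1) ∈ M := by
  obtain ⟨n, hn⟩ := exists_pow_eq_self_of_coprime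
    (h.symm.coprime_dvd_right (orderOf_dvd_natCard m.1))
  have hpow : (m ^ Nat.card R) ^ n = (m.1, 1) :=
    Prod.ext hn (by rw [Prod.pow_snd, Prod.pow_snd, pow_card_eq_one', one_pow])
  exact hpow ▸ M.pow_mem (M.pow_mem hm _) n

theorem eq_prod_comap_of_coprime (h : (Nat.card G).Coprime (Nat.card R)) (M : Subgroup (G × R)) :
    M = (M.comap (MonoidHom.inl G R)).prod (M.comap (MonoidHom.inr G R)) := by
  refine le_antisymm (fun m hm => ?_) (Subgroup.prod_le_iff.2
    ⟨Subgroup.map_comap_le _ _, Subgroup.map_comap_le _ _⟩)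
  have hl : (m.1, 1) ∈ M := inl_mem_of_coprime h hm
  have hr : (m.1, 1)⁻¹ * m = (1, m.2) := by ext <;> simp
  exact ⟨hl, show (1, m.2) ∈ M from hr ▸ M.mul_mem (M.inv_mem hl) hm⟩

theorem Comp.mk_inj {H V U : Type} [Group H] [Subsingleton H] [MulAction (G × Hᵐᵒᵖ) V]
    [MulAction (H × Rᵐᵒᵖ) U] {v v' : V} {u u' : U} :
    Comp.mk G H R v u = Comp.mk G H R v' u' ↔ v = v' ∧ u = u' := by
  refine ⟨fun h => ?_, fun ⟨hv, hu⟩ => by rw [hv, hu]⟩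
  refine Prod.ext_iff.1 (congrArg (Comp.lift Prod.mk fun h v u => ?_) h)
  rw [Subsingleton.elim h 1, op_one, Prod.mk_one_one, one_smul, Prod.mk_one_one, one_smul]

instance [Finite R] : Finite Rᵐᵒᵖ := Finite.of_equiv R opEquiv

theorem mk_quotient_prod [Finite G] [Finite R] (A : Subgroup G) (B : Subgroup Rᵐᵒᵖ) :
    GSetClass.mk (G × Rᵐᵒᵖ) ((G × Rᵐᵒᵖ) ⧸ A.prod B) =
      compClass (GSetClass.mk (G × Unitᵐᵒᵖ) ((G × Unitᵐᵒᵖ) ⧸ A.prod ⊤))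
        (GSetClass.mk (Unit × Rᵐᵒᵖ) ((Unit × Rᵐᵒᵖ) ⧸ (⊤ : Subgroup Unit).prod B)) := by
  let A' : Subgroup (G × Unitᵐᵒᵖ) := A.prod ⊤
  let B' : Subgroup (Unit × Rᵐᵒᵖ) := (⊤ : Subgroup Unit).prod B
  let x : Comp G Unit R ((G × Unitᵐᵒᵖ) ⧸ A') ((Unit × Rᵐᵒᵖ) ⧸ B') :=
    Comp.mk G Unit R ((1 : G × Unitᵐᵒᵖ) : _ ⧸ A') ((1 : Unit × Rᵐᵒᵖ) : _ ⧸ B')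
  have hsmul (g : G) (r : Rᵐᵒᵖ) : ((g, r) : G × Rᵐᵒᵖ) • x =
      Comp.mk G Unit R (((g, 1) : G × Unitᵐᵒᵖ) : _ ⧸ A') (((1, r) : Unit × Rᵐᵒᵖ) : _ ⧸ B') := by
    simp only [x, Comp.smul_mk, MulAction.Quotient.smul_coe, smul_eq_mul, mul_one]
  have hstab : MulAction.stabilizer (G × Rᵐᵒᵖ) x = A.prod B := by
    ext ⟨g, r⟩
    rw [MulAction.mem_stabilizer_iff, hsmul, Comp.mk_inj, eq_comm, QuotientGroup.eq, eq_comm,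
      QuotientGroup.eq]
    simp [A', B', Subgroup.mem_prod]
  have : MulAction.IsPretransitive (G × Rᵐᵒᵖ)
      (Comp G Unit R ((G × Unitᵐᵒᵖ) ⧸ A') ((Unit × Rᵐᵒᵖ) ⧸ B')) := by
    refine (MulAction.isPretransitive_iff_base x).2 fun y => ?_
    induction y using Comp.ind with | h v u =>
    induction v using QuotientGroup.induction_on with | H v =>
    induction u using QuotientGroup.induction_on with | H u =>
    exact ⟨(v.1, u.2), hsmul v.1 u.2⟩
  rw [compClass_mk, ← hstab, mk_quotient_stabilizer]

variable {k : Type} [CommRing k]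

theorem act_eq_zero_of_coprime {F : BisetFunctor k} [Subsingleton (F.val (trivialGroup k))]
    {G H : BisetCat k} (h : (Nat.card G.carrier).Coprime (Nat.card H.carrier)) (α : G ⟶ H)
    (v : F.val G) : F.act α v = 0 := by
  suffices LinearMap.ker (F.evalAt v H) = ⊤ from Submodule.eq_top_iff'.1 this α
  refine Lin.eq_top_of_gen_mem fun u => ?_
  induction u using gset_ind with
  | h0 => rw [map_zero]; exact zero_mem _
  | hadd a b ha hb => rw [map_add]; exact add_mem ha hb
  | hK M =>
    have hcop : (Nat.card H.carrier).Coprime (Nat.card G.carrierᵐᵒᵖ) := by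
      rw [← Nat.card_congr (opEquiv (α := G.carrier))]
      exact h.symm
    rw [eq_prod_comap_of_coprime hcop M, mk_quotient_prod, ← compLin_gen]
    refine (F.act_comp (H := trivialGroup k) (gen k _) (gen k _) v).trans ?_
    rw [Subsingleton.elim (F.act (H := trivialGroup k) _ v) 0, map_zero]

/-- The subfunctor of `F` of the elements killed by all morphisms to `T`: the largest subfunctor
of `F` that vanishes at `T`. -/
def annihilator (F : BisetFunctor k) (T : BisetCat k) : Subfunctor F where
  obj G := ⨅ α : G ⟶ T, LinearMap.ker (F.act α)
  map_mem α v hv := by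
    simp only [Submodule.mem_iInf, LinearMap.mem_ker] at hv ⊢
    exact fun β => (F.act_comp α β v).symm.trans (hv (α ≫ β))

theorem mem_annihilator {F : BisetFunctor k} {T G : BisetCat k} {v : F.val G} :
    v ∈ (annihilator F T).obj G ↔ ∀ α : G ⟶ T, F.act α v = 0 :=
  Submodule.mem_iInf _

theorem Generates.subsingleton_val {F : BisetFunctor k} {𝒢 : Set (Elements F)}
    (h𝒢 : Generates F 𝒢) {T : BisetCat k} (h : ∀ p ∈ 𝒢, ∀ α : p.1 ⟶ T, F.act α p.2 = 0) :
    Subsingleton (F.val T) := by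
  refine subsingleton_of_forall_eq 0 fun v => ?_
  have hv : v ∈ (annihilator F T).obj T := by
    rw [h𝒢.obj_eq_top (fun p hp => mem_annihilator.2 (h p hp))]
    exact Submodule.mem_top
  rw [← F.act_id v, mem_annihilator.1 hv]

theorem FinitelyGenerated.exists_subsingleton_val_of_coprime {F : BisetFunctor k}
    (hF : FinitelyGenerated F) [Subsingleton (F.val (trivialGroup k))] :
    ∃ N ≠ 0, ∀ T : BisetCat k, N.Coprime (Nat.card T.carrier) → Subsingleton (F.val T) := by
  obtain ⟨𝒢, hfin, h𝒢⟩ := hF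
  refine ⟨∏ p ∈ hfin.toFinset, Nat.card p.1.carrier,
    Finset.prod_ne_zero_iff.2 fun p _ => Nat.card_pos.ne', fun T hT => ?_⟩
  refine h𝒢.subsingleton_val fun p hp α => act_eq_zero_of_coprime (hT.coprime_dvd_left ?_) α p.2
  exact Finset.dvd_prod_of_mem (fun p : Elements F => Nat.card p.1.carrier)
    (hfin.mem_toFinset.2 hp)

end Coprime

section Point

variable {k G : Type} [CommRing k] [Group G]

variable (k) in
/-- The class of the one-point set in `kB(1)`. -/
def point : (burnsideFunctor k).val (trivialGroup k) := gen k (1 : GSetClass Unit)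

theorem exists_actClass_one_eq (x : GSetClass G) : ∃ u : BisetClass G Unit, actClass u 1 = x := by
  induction x using GSetClass.ind with | h X =>
  let _ : MulAction (G × Unitᵐᵒᵖ) X := MulAction.compHom X (MonoidHom.fst G Unitᵐᵒᵖ)
  refine ⟨GSetClass.mk _ X, ?_⟩
  rw [GSetClass.one_def, actClass_mk]
  refine GSetClass.mk_eq_mk ⟨Tens.lift (fun x _ => x) fun _ x _ => one_smul G x,
    fun x => Tens.mk G Unit x (), fun y => ?_, fun _ => rfl⟩ fun g y => ?_ <;>
  induction y using Tens.ind with | h x _ => rfl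

theorem burnsideFunctor_act_gen {G H : BisetCat k} (u : BisetClass H.carrier G.carrier)
    (x : GSetClass G.carrier) :
    (burnsideFunctor k).act (G := G) (H := H) (gen k u) (gen k x) = gen k (actClass u x) := by
  have h : (burnsideFunctor k).act (G := G) (H := H) (gen k u) = burnsideAct k u :=
    mkFunctor_act_gen _ _ _ _ G H u
  rw [h]
  exact burnsideAct_gen u x

theorem generates_point : Generates (burnsideFunctor k) {⟨trivialGroup k, point k⟩} := by
  refine fun G => Lin.eq_top_of_gen_mem fun x => ?_
  obtain ⟨u, rfl⟩ := exists_actClass_one_eq x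
  exact Set.mem_of_eq_of_mem (burnsideFunctor_act_gen (G := trivialGroup k) u 1).symm
    ((generated _ _).map_mem (G := trivialGroup k) (gen k u) (mem_generated rfl))

theorem mk_quotient_top [Finite G] : GSetClass.mk G (G ⧸ (⊤ : Subgroup G)) = 1 := by
  have : Unique (G ⧸ (⊤ : Subgroup G)) := @Unique.mk' _ _ QuotientGroup.subsingleton_quotient_top
  exact GSetClass.mk_eq_mk (Equiv.ofUnique _ Unit) fun _ _ => rfl

theorem span_gen_one [Subsingleton G] : Submodule.span k {gen k (1 : GSetClass G)} = ⊤ := by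
  refine Lin.eq_top_of_gen_mem fun x => ?_
  induction x using gset_ind with
  | h0 => rw [map_zero]; exact zero_mem _
  | hadd a b ha hb => rw [map_add]; exact add_mem ha hb
  | hK K =>
    rw [Subsingleton.elim K ⊤, mk_quotient_top]
    exact Submodule.mem_span_singleton_self _

theorem span_point : Submodule.span k {point k} = ⊤ :=
  span_gen_one (G := Unit)

end Point

section Duality

variable {G : Type} [Group G] [Finite G]

theorem signPlus_injective : Function.Injective signPlus := by
  decide

theorem jClass_quotient_eq_iff {K L : Subgroup G} {u v : UnitGroup G} :
    jClass (GSetClass.mk G (G ⧸ K)) u = jClass (GSetClass.mk G (G ⧸ L)) v ↔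
      mark K (u.toMul : Burnside G) = mark L (v.toMul : Burnside G) := by
  rw [jClass_quotient, jClass_quotient, signPlus_injective.eq_iff, Additive.ofMul.injective.eq_iff,
    Units.ext_iff]
  rfl

theorem eq_of_forall_jClass_quotient_eq {u v : UnitGroup G}
    (h : ∀ K : Subgroup G, jClass (GSetClass.mk G (G ⧸ K)) u = jClass (GSetClass.mk G (G ⧸ K)) v) :
    u = v :=
  Additive.toMul.injective (Units.ext (burnside_ext fun K => jClass_quotient_eq_iff.1 (h K)))

instance : Finite (UnitGroup G) :=
  Finite.of_injective (fun u (K : Subgroup G) => jClass (GSetClass.mk G (G ⧸ K)) u) fun _ _ h =>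
    eq_of_forall_jClass_quotient_eq (congrFun h)

theorem jLin_surjective (G : Type) [Group G] [Finite G] : Function.Surjective (jLin G) := by
  have hspan : Submodule.span (ZMod 2) (Set.range (jClass (G := G))) = ⊤ := by
    refine Submodule.span_eq_top_of_ne_zero fun u hu => ?_
    by_contra! h
    exact hu (eq_of_forall_jClass_quotient_eq fun K => (h _ ⟨_, rfl⟩).trans (map_zero _).symm)
  rw [← LinearMap.range_eq_top, eq_top_iff, ← hspan, Submodule.span_le]
  rintro _ ⟨x, rfl⟩
  exact ⟨gen (ZMod 2) x, jLin_gen x⟩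

theorem jmath_surjective (G : BisetCat (ZMod 2)) : Function.Surjective (component jmath G) :=
  jLin_surjective G.carrier

/-- The generator of the dual of `Bˣ(1)`, the image of the one-point set. -/
def dualPoint : dualUnitFunctor.val (trivialGroup (ZMod 2)) :=
  component jmath (trivialGroup (ZMod 2)) (point (ZMod 2))

theorem generates_dualPoint : Generates dualUnitFunctor {⟨trivialGroup (ZMod 2), dualPoint⟩} := by
  have h := (generates_point (k := ZMod 2)).image jmath_surjective
  rwa [Set.image_singleton] at h

theorem span_dualPoint : Submodule.span (ZMod 2) {dualPoint} = ⊤ := by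
  have h := congrArg (Submodule.map (component jmath (trivialGroup (ZMod 2)))) span_point
  rwa [Submodule.map_span, Set.image_singleton, Submodule.map_top,
    LinearMap.range_eq_top.2 (jmath_surjective _)] at h

theorem dualPoint_ne_zero : dualPoint ≠ 0 := by
  intro h
  let u : UnitGroup Unit := Additive.ofMul (-1)
  have hj : jClass (1 : GSetClass Unit) u = jClass (1 : GSetClass Unit) 0 :=
    (LinearMap.congr_fun ((jLin_gen _).symm.trans h) u).trans (map_zero _).symm
  rw [← mk_quotient_top, jClass_quotient_eq_iff] at hj
  norm_num [u] at hj

end Duality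

section TrivialGroup

theorem nonempty_dualUnitFunctor_trivialGroup_equiv :
    Nonempty (dualUnitFunctor.val (trivialGroup (ZMod 2)) ≃ₗ[ZMod 2] ZMod 2) :=
  ⟨((LinearEquiv.toSpanNonzeroSingleton (ZMod 2) _ dualPoint dualPoint_ne_zero).trans
    (LinearEquiv.ofTop _ span_dualPoint)).symm⟩

theorem generates_dualUnitFunctor {u : dualUnitFunctor.val (trivialGroup (ZMod 2))}
    (hu : u ≠ 0) : Generates dualUnitFunctor {⟨trivialGroup (ZMod 2), u⟩} := by
  obtain ⟨c, rfl⟩ := Submodule.mem_span_singleton.1 (Submodule.eq_top_iff'.1 span_dualPoint u)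
  have hc0 : c ≠ 0 := left_ne_zero_of_smul hu
  have hc : c = 1 := Fin.eq_one_of_ne_zero c hc0
  rw [hc, one_smul]
  exact generates_dualPoint

instance : Subsingleton (kernelFunctor.val (trivialGroup (ZMod 2))) := by
  refine subsingleton_of_forall_eq 0 fun ⟨x, hx⟩ => Subtype.ext ?_
  obtain ⟨c, hcx⟩ := Submodule.mem_span_singleton.1 (Submodule.eq_top_iff'.1 span_point x)
  have hc : c • dualPoint = 0 := by
    rw [dualPoint, ← map_smul, hcx]
    exact hx
  have hx0 : x = 0 := by
    rw [← hcx, (smul_eq_zero.1 hc).resolve_right dualPoint_ne_zero, zero_smul]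
  exact hx0

end TrivialGroup

section PGroup

theorem eq_of_isUnit_of_int_modEq {a b n : ℤ} (ha : IsUnit a) (hb : IsUnit b) (hn : 2 < n)
    (h : a ≡ b [ZMOD n]) : a = b := by
  have habs : |b - a| ≤ 2 := by
    rw [← one_add_one_eq_two]
    exact (abs_sub b a).trans_eq (by rw [Int.isUnit_iff_abs_eq.1 ha, Int.isUnit_iff_abs_eq.1 hb])
  exact (sub_eq_zero.1 (Int.eq_zero_of_abs_lt_dvd h.dvd (habs.trans_lt hn))).symm

variable {G : Type} [Group G] {p : ℕ} [Fact p.Prime]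

theorem card_fix_bot (X : Type) [MulAction G X] : Nat.card (Fix (⊥ : Subgroup G) X) = Nat.card X :=
  Nat.card_congr (Equiv.subtypeUnivEquiv fun x k hk => by rw [Subgroup.mem_bot.1 hk, one_smul])

theorem mark_modEq_of_isPGroup {K : Subgroup G} (hK : IsPGroup p K) (a : Burnside G) :
    mark ⊥ a ≡ mark K a [ZMOD p] := by
  have hof (x : GSetClass G) : mark ⊥ (Gro.of x) ≡ mark K (Gro.of x) [ZMOD p] := by
    induction x using GSetClass.ind with | h X =>
    have hfix : Nat.card (Fix K X) = Nat.card (MulAction.fixedPoints K X) :=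
      Nat.card_congr (Equiv.subtypeEquivRight fun _ =>
        ⟨fun h k => h k k.2, fun h k hk => h ⟨k, hk⟩⟩)
    rw [mark_of, mark_of, fixCard_mk, fixCard_mk, card_fix_bot, hfix]
    exact Int.natCast_modEq_iff.2 (hK.card_modEq_card_fixedPoints X)
  induction a using Gro.ind with | h x y =>
  rw [map_sub, map_sub]
  exact (hof x).sub (hof y)

theorem jClass_quotient_bot_eq [Finite G] (hp : 2 < p) {K : Subgroup G} (hK : IsPGroup p K) :
    jClass (GSetClass.mk G (G ⧸ (⊥ : Subgroup G))) = jClass (GSetClass.mk G (G ⧸ K)) := by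
  refine LinearMap.ext fun u => jClass_quotient_eq_iff.2 ?_
  exact eq_of_isUnit_of_int_modEq (u.toMul.isUnit.map (mark ⊥)) (u.toMul.isUnit.map (mark K))
    (mod_cast hp) (mark_modEq_of_isPGroup hK _)

theorem isEmpty_fix_top_quotient {K : Subgroup G} (hK : K ≠ ⊤) :
    IsEmpty (Fix (⊤ : Subgroup G) (G ⧸ K)) where
  false x := by
    have heq (y : G ⧸ K) : y = x := by
      obtain ⟨g, rfl⟩ := MulAction.exists_smul_eq G x.1 y
      exact x.2 g (Subgroup.mem_top g)
    exact hK (QuotientGroup.subgroup_eq_top_of_subsingleton K (subsingleton_of_forall_eq _ heq))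

theorem gen_quotient_ne_gen_one {k : Type} [CommRing k] [Nontrivial k] [Finite G] {K : Subgroup G}
    (hK : K ≠ ⊤) : gen k (GSetClass.mk G (G ⧸ K)) ≠ gen k 1 := by
  intro h
  have := isEmpty_fix_top_quotient hK
  let φ : GSetClass G →+ k := (Nat.castAddMonoidHom k).comp (fixCard ⊤ : GSetClass G →+* ℕ)
  have hφ := congrArg (extend (k := k) φ) h
  rw [extend_gen, extend_gen] at hφ
  simp [φ, fixCard_mk] at hφ

theorem nontrivial_kernelFunctor_val {G : BisetCat (ZMod 2)} [Nontrivial G.carrier] (hp : 2 < p)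
    (hG : IsPGroup p G.carrier) : Nontrivial (kernelFunctor.val G) := by
  let x : Lin (ZMod 2) (GSetClass G.carrier) :=
    gen (ZMod 2) (GSetClass.mk G.carrier (G.carrier ⧸ (⊥ : Subgroup G.carrier))) - gen (ZMod 2) 1
  have hx : jLin G.carrier x = 0 := by
    rw [map_sub, jLin_gen, jLin_gen, ← mk_quotient_top,
      jClass_quotient_bot_eq hp (hG.to_subgroup ⊤), sub_self]
  refine ⟨⟨x, hx⟩, 0, fun h =>
    gen_quotient_ne_gen_one (k := ZMod 2) (bot_ne_top (α := Subgroup G.carrier)) ?_⟩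
  exact sub_eq_zero.1 (congrArg Subtype.val h)

end PGroup

theorem kernelFunctor_not_finitelyGenerated : ¬ FinitelyGenerated kernelFunctor := by
  intro h
  obtain ⟨N, hN, hcoprime⟩ := h.exists_subsingleton_val_of_coprime
  obtain ⟨p, hlt, hp⟩ := Nat.exists_infinite_primes (max N 2 + 1)
  have : Fact p.Prime := ⟨hp⟩
  let T : BisetCat (ZMod 2) := ⟨Multiplicative (ZMod p)⟩
  have hcard : Nat.card T.carrier = p := Nat.card_zmod p
  have : Nontrivial T.carrier := inferInstanceAs (Nontrivial (Multiplicative (ZMod p)))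
  have hT : IsPGroup p T.carrier := IsPGroup.of_card (hcard.trans (pow_one p).symm)
  have hNp : N.Coprime (Nat.card T.carrier) := by
    rw [hcard]
    exact (Nat.coprime_of_lt_prime hN (by omega) hp).symm
  exact not_subsingleton_iff_nontrivial.2 (nontrivial_kernelFunctor_val (by omega) hT)
    (hcoprime T hNp)

theorem dualUnitFunctor_not_finitelyPresented : ¬ FinitelyPresented dualUnitFunctor := fun h =>
  kernelFunctor_not_finitelyGenerated <|
    h.finitelyGenerated_kernel jmath_surjective ⟨_, Set.finite_singleton _, generates_point⟩

end BurnsideUnits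

end

theorem proposition6p4 :
    (Nonempty (BurnsideUnits.dualUnitFunctor.val
        (BurnsideUnits.trivialGroup (ZMod 2)) ≃ₗ[ZMod 2] ZMod 2) ∧
      ∀ u : BurnsideUnits.dualUnitFunctor.val (BurnsideUnits.trivialGroup (ZMod 2)), u ≠ 0 →
        BurnsideUnits.Generates BurnsideUnits.dualUnitFunctor
          {⟨BurnsideUnits.trivialGroup (ZMod 2), u⟩}) ∧
    ¬ BurnsideUnits.FinitelyGenerated BurnsideUnits.kernelFunctor ∧
    ¬ BurnsideUnits.FinitelyPresented BurnsideUnits.dualUnitFunctor :=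
  ⟨⟨BurnsideUnits.nonempty_dualUnitFunctor_trivialGroup_equiv,
      fun _ hu => BurnsideUnits.generates_dualUnitFunctor hu⟩,
    BurnsideUnits.kernelFunctor_not_finitelyGenerated,
    BurnsideUnits.dualUnitFunctor_not_finitelyPresented⟩
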